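/- Let $X$ be a complex Hilbert space with inner product $\langle\cdot,\cdot\rangle$ (linear in the first argument), and let $A:D(A)\subset X\to X$ generate a strongly continuous semigroup $(T(t))_{t\ge 0}$ on $X$. Write $\rho$, $\sigma$, $\sigma_p$ for resolvent set, spectrum and point spectrum, and $R(\lambda,A)=(\lambda I-A)^{-1}$. Suppose that $A$ is a Riesz-spectral operator: $A$ is closed and linear, its eigenvalues are $\{\lambda_n:n\in\mathbb N\}$, pairwise distinct and simple, with corresponding eigenvectors $\phi_n$; the closed linear span of $\{\phi_n\}$ is $X$, and there are $M_a,M_b>0$ with $M_a\sum_{n=1}^N|a_n|^2\le\|\sum_{n=1}^N a_n\phi_n\|^2\le M_b\sum_{n=1}^N|a_n|^2$ for all $N\in\mathbb N$ and $a_1,\dots,a_N\in\mathbb C$; and $\overline{\{\lambda_n:n\in\mathbb N\}}$ is totally disconnected. Let $\psi_n$ be eigenvectors of $A^*$ for the eigenvalues $\overline{\lambda_n}$ with $\langle\phi_n,\psi_m\rangle=1$ if $n=m$ and $0$ otherwise. Let $B\in\mathcal L(\mathbb C,X)$ and $F\in\mathcal L(X,\mathbb C)$ be given by $Bu=bu$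 and $Fx=\langle x,f\rangle$ with $b,f\in X$. Assume: (A1) there are $\alpha>0$ and $\delta>0$ such that only finitely many elements of $\{\lambda_n:n\in\mathbb N\}$ lie in $\{s\in\mathbb C\setminus\{0\}:\operatorname{Re}s>-\alpha,\ |\arg s|<\pi/2+\delta\}$; (A2) $\{\lambda_n:n\in\mathbb N\}\cap i\mathbb R=\emptyset$; (A3) $0\in\overline{\{\lambda_n:n\in\mathbb N\}}$; (A4) $A+BF$ generates a uniformly bounded strongly continuous semigroup on $X$, $\sigma_p(A+BF)\cap i\mathbb R=\emptyset$, $\sigma(A+BF)\cap i\mathbb R=\{0\}$, and $\sup_{\omega\in\mathbb R,\,|\omega|>1}\|R(i\omega,A+BF)\|<\infty$; (A5) $\displaystyle\sum_{n=1}^\infty\left|\frac{\langle b,\psi_n\rangle}{\lambda_n}\right|^2<\infty$; (A6) $\displaystyle\sum_{n=1}^\infty\frac{\langle b,\psi_n\rangle\langle\phi_n,f\rangle}{\lambda_n}\ne-1$. For $t\ge0$ put $S(t)=\int_0^tT(s)B\,ds\in\mathcal L(\mathbb C,X)$ and $\Delta(t)=T(t)+S(t)F\in\mathcal L(X)$.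 **Theorem.** There exists $\tau^*>0$ such that for every $\tau\in(0,\tau^*)$ the discrete semigroup $(\Delta(\tau)^k)_{k\in\mathbb N}$ is power bounded, that is, $\sup_{k\in\mathbb N}\|\Delta(\tau)^k\|<\infty$. -/

import Mathlib

open Filter Topology

namespace SampledData

section UnboundedOperators

variable {X : Type*} [NormedAddCommGroup X] [InnerProductSpace ℂ X]

/-- `z` is an eigenvalue of the (possibly unbounded) operator `A` with eigenvector `x`. -/
def IsEigenpair (A : X →ₗ.[ℂ] X) (z : ℂ) (x : X) : Prop :=
  x ≠ 0 ∧ ∃ hx : x ∈ A.domain, A ⟨x, hx⟩ = z • x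

/-- The point spectrum `σ_p(A)`. -/
def pointSpectrum (A : X →ₗ.[ℂ] X) : Set ℂ :=
  {z | ∃ x : X, IsEigenpair A z x}

/-- The bounded operator `R` is the resolvent `R(z, A) = (zI - A)⁻¹`: it maps `X` into `D(A)` and is
a two-sided inverse of `zI - A : D(A) → X`. -/
def IsResolvent (A : X →ₗ.[ℂ] X) (z : ℂ) (R : X →L[ℂ] X) : Prop :=
  (∀ x : X, ∃ hx : R x ∈ A.domain, z • R x - A ⟨R x, hx⟩ = x) ∧
  (∀ x : A.domain, R (z • (x : X) - A x) = x)

/-- The resolvent set `ρ(A)`. -/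
def resolventSet (A : X →ₗ.[ℂ] X) : Set ℂ :=
  {z | ∃ R : X →L[ℂ] X, IsResolvent A z R}

/-- The spectrum `σ(A)`. -/
def spectrum (A : X →ₗ.[ℂ] X) : Set ℂ :=
  (resolventSet A)ᶜ

/-- The sum `A + K` of an unbounded operator `A` and a bounded operator `K`, with domain `D(A)`. -/
def addBounded (A : X →ₗ.[ℂ] X) (K : X →L[ℂ] X) : X →ₗ.[ℂ] X :=
  (K : X →ₗ[ℂ] X) +ᵥ A

/-- A strongly continuous semigroup `(T(t))_{t ≥ 0}` of bounded operators on `X`. The values of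
`T` at negative times carry no information and are never used. -/
structure C0Semigroup (X : Type*) [NormedAddCommGroup X] [InnerProductSpace ℂ X] where
  /-- The operators of the semigroup. -/
  T : ℝ → X →L[ℂ] X
  map_zero : T 0 = ContinuousLinearMap.id ℂ X
  map_add : ∀ s t : ℝ, 0 ≤ s → 0 ≤ t → T (s + t) = (T s).comp (T t)
  strong_cont : ∀ x : X, ContinuousOn (fun t : ℝ => T t x) (Set.Ici 0)

/-- `A` is the generator of the semigroup `S`: for all `x` and `y`, one has `x ∈ D(A)` and
`A x = y` if and only if `(T(t) x - x) / t → y` as `t ↓ 0`. -/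
def IsGenerator (A : X →ₗ.[ℂ] X) (S : C0Semigroup X) : Prop :=
  ∀ x y : X, (∃ hx : x ∈ A.domain, A ⟨x, hx⟩ = y) ↔
    Tendsto (fun t : ℝ => (t : ℂ)⁻¹ • (S.T t x - x)) (𝓝[>] 0) (𝓝 y)

/-- The semigroup is uniformly bounded: `sup_{t ≥ 0} ‖T(t)‖ < ∞`. -/
def C0Semigroup.UniformlyBounded (S : C0Semigroup X) : Prop :=
  ∃ M : ℝ, ∀ t : ℝ, 0 ≤ t → ‖S.T t‖ ≤ M

/-- `φ` is a Riesz basis of `X`. -/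
def IsRieszBasis (φ : ℕ → X) : Prop :=
  (Submodule.span ℂ (Set.range φ)).topologicalClosure = ⊤ ∧
  ∃ Ma Mb : ℝ, 0 < Ma ∧ 0 < Mb ∧ ∀ (N : ℕ) (a : ℕ → ℂ),
    Ma * ∑ n ∈ Finset.range N, ‖a n‖ ^ 2 ≤ ‖∑ n ∈ Finset.range N, a n • φ n‖ ^ 2 ∧
    ‖∑ n ∈ Finset.range N, a n • φ n‖ ^ 2 ≤ Mb * ∑ n ∈ Finset.range N, ‖a n‖ ^ 2

/-- `A` is a Riesz-spectral operator whose eigenvalues are the `lam n`, all simple, with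
corresponding eigenvectors `φ n`. -/
structure IsRieszSpectral (A : X →ₗ.[ℂ] X) (lam : ℕ → ℂ) (φ : ℕ → X) : Prop where
  closed : A.IsClosed
  eigenvalues : pointSpectrum A = Set.range lam
  distinct : Function.Injective lam
  eigenvector : ∀ n, IsEigenpair A (lam n) (φ n)
  simple : ∀ (n : ℕ) (x : X), IsEigenpair A (lam n) x → ∃ c : ℂ, x = c • φ n
  basis : IsRieszBasis φ
  totallyDisconnected : IsTotallyDisconnected (closure (Set.range lam))

end UnboundedOperators

/-- The open half-plane `ℂ_a = {s : Re s > a}`. -/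
def halfPlane (a : ℝ) : Set ℂ := {s | a < s.re}

/-- The open sector `Σ_d = {s ≠ 0 : |arg s| < d}`. -/
def sector (d : ℝ) : Set ℂ := {s | s ≠ 0 ∧ |s.arg| < d}

/-- The imaginary axis `iℝ`. -/
def imagAxis : Set ℂ := {s | s.re = 0}

section System

variable {X : Type*} [NormedAddCommGroup X] [InnerProductSpace ℂ X] [CompleteSpace X]

/-- The standing assumption on the plant `A`, the control operator `B` and the feedback operator
`F`. Mathlib's inner product is conjugate-linear in its first argument, so that `⟨x, ξ⟩`, linear
in `x`, is `inner ℂ ξ x`. -/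
structure SystemAssumption (A : X →ₗ.[ℂ] X) (B : ℂ →L[ℂ] X) (F : X →L[ℂ] ℂ)
    (lam : ℕ → ℂ) (φ ψ : ℕ → X) (b f : X) : Prop where
  rieszSpectral : IsRieszSpectral A lam φ
  /-- The `ψ n` are eigenvectors of the adjoint `A*` for the eigenvalues `conj (lam n)`. -/
  adjointEigenvector : ∀ n, IsEigenpair A.adjoint (starRingEnd ℂ (lam n)) (ψ n)
  biorthogonal : ∀ n m, inner ℂ (ψ m) (φ n) = if n = m then (1 : ℂ) else 0
  control_eq : ∀ u : ℂ, B u = u • b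
  feedback_eq : ∀ x : X, F x = inner ℂ f x
  finite_unstable : ∃ a d : ℝ, 0 < a ∧ 0 < d ∧
    (Set.range lam ∩ (halfPlane (-a) ∩ sector (Real.pi / 2 + d))).Finite
  no_imaginary : Set.range lam ∩ imagAxis = ∅
  zero_mem_closure : (0 : ℂ) ∈ closure (Set.range lam)
  closedLoop_bounded : ∃ S : C0Semigroup X,
    IsGenerator (addBounded A (B.comp F)) S ∧ S.UniformlyBounded
  closedLoop_pointSpectrum : pointSpectrum (addBounded A (B.comp F)) ∩ imagAxis = ∅
  closedLoop_spectrum : spectrum (addBounded A (B.comp F)) ∩ imagAxis = {0}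
  closedLoop_resolvent : ∃ M : ℝ, ∀ ω : ℝ, 1 < |ω| → ∃ R : X →L[ℂ] X,
    IsResolvent (addBounded A (B.comp F)) (Complex.I * ω) R ∧ ‖R‖ ≤ M
  control_summable : Summable fun n => ‖inner ℂ (ψ n) b / lam n‖ ^ 2
  /-- The series converges absolutely by the previous field and the Riesz basis property. -/
  control_feedback : ∑' n, inner ℂ (ψ n) b * inner ℂ f (φ n) / lam n ≠ (-1 : ℂ)

/-- `S(t) = ∫₀ᵗ T(s) B ds`, an element of `L(ℂ, X)`. -/
noncomputable def inputMap (T : C0Semigroup X) (B : ℂ →L[ℂ] X) (t : ℝ) : ℂ →L[ℂ] X :=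
  ∫ s in (0 : ℝ)..t, (T.T s).comp B

/-- `Δ(t) = T(t) + S(t) F`. -/
noncomputable def sampledOperator (T : C0Semigroup X) (B : ℂ →L[ℂ] X) (F : X →L[ℂ] ℂ)
    (t : ℝ) : X →L[ℂ] X :=
  T.T t + (inputMap T B t).comp F

/-- The discrete semigroup `(D ^ k)` is power bounded: `sup_k ‖D ^ k‖ < ∞`. -/
def PowerBounded (D : X →L[ℂ] X) : Prop :=
  ∃ M : ℝ, ∀ k : ℕ, ‖D ^ k‖ ≤ M

end System

end SampledData

/-! In the coordinates ⟨x, ψ_n⟩ the operator T(τ) is multiplication by e^{τλ_n}, and Δ(τ) is a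
rank-one perturbation of it. Only finitely many λ_n have positive real part; removing those modes
leaves a power bounded diagonal operator T', and Δ(τ) = T' + finite rank. Since 0 is a limit of the
λ_n, the multipliers accumulate at 1, so (1 - wT')⁻¹ blows up near the unit circle and no
small-perturbation argument applies.

What survives is that (1 - wT')⁻¹ w S(τ)1 extends continuously to |w| ≤ 1. On stable modes its
coefficients are w(e^{τλ_n} - 1)/(1 - w e^{τλ_n}) · ⟨b, ψ_n⟩/λ_n. The first factor is at most
|λ_n|/|Re λ_n| ≤ K(1 + |λ_n|), uniformly in w (`norm_sampled_mode_le`, `exists_inclination_bound`),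
so by (A5) the product is dominated by a square-summable sequence.

Hence 1 - wΔ(τ) = (1 - wT')N(w), where N(w) is the identity minus a finite-rank operator, continuous
on the closed disc. If every N(w) is injective, compactness bounds N(w)⁻¹ uniformly, and the
resolvents of Δ(τ) and its adjoint are controlled by those of T' and its adjoint. By Parseval,
integrals of squared resolvents over circles are Abel sums of squared orbit norms; Abel bounds for
an operator and its adjoint give power boundedness (`powerBounded_add_finiteRank`,
`powerBounded_of_abel_bounds`).

Injectivity is where small τ enters. With w = e^{-τs} and τ → 0, the sampled characteristic sum
tends to the transfer function ∑ ⟨b, ψ_n⟩⟨φ_n, f⟩/(s - λ_n). The value 1 would produce an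
eigenvector of A + BF for s in the closed right half-plane. The limit s = 0 is settled by (A6), s =
∞ by decay, and a pole s = λ_m by the nonvanishing of its residue
(`exists_forall_tsum_sampled_mode_ne_one`). -/

namespace SampledData

/-! ### Riesz bases: analysis, synthesis and expansion. -/

section RieszBasis

variable {X : Type*} [NormedAddCommGroup X] [InnerProductSpace ℂ X]

/-- The constants of a Riesz basis, with the norm bounds stated over arbitrary finite index sets. -/
theorem IsRieszBasis.exists_bounds {φ : ℕ → X} (hb : IsRieszBasis φ) :
    ∃ Ma Mb : ℝ, 0 < Ma ∧ 0 < Mb ∧ ∀ (s : Finset ℕ) (a : ℕ → ℂ),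
      Ma * ∑ n ∈ s, ‖a n‖ ^ 2 ≤ ‖∑ n ∈ s, a n • φ n‖ ^ 2 ∧
      ‖∑ n ∈ s, a n • φ n‖ ^ 2 ≤ Mb * ∑ n ∈ s, ‖a n‖ ^ 2 := by
  obtain ⟨-, Ma, Mb, hMa, hMb, H⟩ := hb
  refine ⟨Ma, Mb, hMa, hMb, fun s a => ?_⟩
  obtain ⟨N, hN⟩ := s.exists_nat_subset_range
  have h1 : ∑ n ∈ Finset.range N, ‖if n ∈ s then a n else 0‖ ^ 2 = ∑ n ∈ s, ‖a n‖ ^ 2 := by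
    rw [← Finset.sum_subset hN]
    · exact Finset.sum_congr rfl fun n hn => by simp [hn]
    · intro n _ hn
      simp [hn]
  have h2 : ∑ n ∈ Finset.range N, (if n ∈ s then a n else 0) • φ n = ∑ n ∈ s, a n • φ n := by
    rw [← Finset.sum_subset hN]
    · exact Finset.sum_congr rfl fun n hn => by simp [hn]
    · intro n _ hn
      simp [hn]
  have := H N fun n => if n ∈ s then a n else 0
  rwa [h1, h2] at this

/-- Square-summable coefficients give a convergent expansion. -/
theorem IsRieszBasis.exists_synthesis_bound [CompleteSpace X] {φ : ℕ → X} (hb : IsRieszBasis φ) :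
    ∃ Mb : ℝ, 0 < Mb ∧ ∀ a : ℕ → ℂ, (Summable fun n => ‖a n‖ ^ 2) →
      (Summable fun n => a n • φ n) ∧ ‖∑' n, a n • φ n‖ ^ 2 ≤ Mb * ∑' n, ‖a n‖ ^ 2 := by
  obtain ⟨Ma, Mb, hMa, hMb, H⟩ := hb.exists_bounds
  refine ⟨Mb, hMb, fun a ha => ?_⟩
  have hs : Summable fun n => a n • φ n := by
    rw [summable_iff_vanishing_norm]
    intro ε hε
    obtain ⟨s, hs⟩ := summable_iff_vanishing_norm.1 ha (ε ^ 2 / Mb) (by positivity)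
    refine ⟨s, fun t ht => ?_⟩
    have h1 := hs t ht
    rw [Real.norm_of_nonneg (Finset.sum_nonneg fun _ _ => by positivity), lt_div_iff₀ hMb] at h1
    have h2 := (H t a).2
    exact lt_of_pow_lt_pow_left₀ 2 hε.le (by linarith)
  refine ⟨hs, ?_⟩
  refine le_of_tendsto (hs.hasSum.norm.pow 2) (Eventually.of_forall fun s => ?_)
  exact (H s a).2.trans (mul_le_mul_of_nonneg_left
    (ha.sum_le_tsum s fun _ _ => by positivity) hMb.le)

variable {φ ψ : ℕ → X} (hb : IsRieszBasis φ)
  (hbi : ∀ n m, inner ℂ (ψ m) (φ n) = if n = m then (1 : ℂ) else 0)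

include hbi in
theorem inner_sum_of_biorthogonal (s : Finset ℕ) (a : ℕ → ℂ) (m : ℕ) :
    inner ℂ (ψ m) (∑ n ∈ s, a n • φ n) = if m ∈ s then a m else 0 := by
  simp [hbi]

include hbi in
theorem inner_tsum_of_biorthogonal {a : ℕ → ℂ} (ha : Summable fun n => a n • φ n) (m : ℕ) :
    inner ℂ (ψ m) (∑' n, a n • φ n) = a m := by
  have h := (innerSL ℂ (ψ m)).hasSum ha.hasSum
  refine h.unique ?_
  have h2 : (fun n => innerSL ℂ (ψ m) (a n • φ n)) = fun n => if n = m then a m else 0 := by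
    ext n
    by_cases hn : n = m <;> simp [hbi, hn]
  rw [h2]
  exact hasSum_ite_eq m (a m)

/-- A closed condition that holds on finite linear combinations of a Riesz basis holds
everywhere. -/
theorem IsRieszBasis.induction {φ : ℕ → X} (hb : IsRieszBasis φ) {P : X → Prop}
    (hP : IsClosed {x | P x}) (h : ∀ (s : Finset ℕ) (a : ℕ → ℂ), P (∑ n ∈ s, a n • φ n)) (x : X) :
    P x := by
  have hd : Dense (Submodule.span ℂ (Set.range φ) : Set X) :=
    (Submodule.dense_iff_topologicalClosure_eq_top).2 hb.1
  refine hd.induction (P := P) (fun y hy => ?_) hP x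
  obtain ⟨l, rfl⟩ := (Finsupp.mem_span_range_iff_exists_finsupp).1 hy
  exact h l.support l

-- On finite combinations this is the lower Riesz inequality, since discarding coefficients only
-- decreases the left side. For a fixed finite index set both sides are continuous in `x`, so
-- density extends it.
include hb hbi in
theorem exists_analysis_bound :
    ∃ Ma : ℝ, 0 < Ma ∧ ∀ x : X, (Summable fun n => ‖inner ℂ (ψ n) x‖ ^ 2) ∧
      Ma * ∑' n, ‖inner ℂ (ψ n) x‖ ^ 2 ≤ ‖x‖ ^ 2 := by
  obtain ⟨Ma, Mb, hMa, hMb, H⟩ := hb.exists_bounds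
  have key : ∀ (t : Finset ℕ) (x : X), Ma * ∑ n ∈ t, ‖inner ℂ (ψ n) x‖ ^ 2 ≤ ‖x‖ ^ 2 := by
    intro t
    refine hb.induction (isClosed_le (by fun_prop) (by fun_prop)) fun s a => ?_
    refine le_trans (mul_le_mul_of_nonneg_left ?_ hMa.le) (H s a).1
    simp only [inner_sum_of_biorthogonal hbi]
    calc ∑ n ∈ t, ‖if n ∈ s then a n else 0‖ ^ 2
        = ∑ n ∈ t with n ∈ s, ‖a n‖ ^ 2 := by
          rw [Finset.sum_filter]
          exact Finset.sum_congr rfl fun n _ => by split_ifs <;> simp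
      _ ≤ ∑ n ∈ s, ‖a n‖ ^ 2 := Finset.sum_le_sum_of_subset_of_nonneg
          (fun n hn => (Finset.mem_filter.1 hn).2) fun _ _ _ => by positivity
  refine ⟨Ma, hMa, fun x => ?_⟩
  have hs : Summable fun n => ‖inner ℂ (ψ n) x‖ ^ 2 :=
    summable_of_sum_le (c := ‖x‖ ^ 2 / Ma) (fun _ => by positivity) fun t => by
      rw [le_div_iff₀' hMa]; exact key t x
  refine ⟨hs, ?_⟩
  rw [← le_div_iff₀' hMa]
  exact hs.tsum_le_of_sum_le fun t => by rw [le_div_iff₀' hMa]; exact key t x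

include hb hbi in
theorem hasSum_inner_smul [CompleteSpace X] (x : X) : HasSum (fun n => (inner ℂ (ψ n) x : ℂ) • φ n) x := by
  obtain ⟨Ma, hMa, hA⟩ := exists_analysis_bound hb hbi
  obtain ⟨Mb, hMb, hS⟩ := hb.exists_synthesis_bound
  have hsum : ∀ x : X, Summable fun n => (inner ℂ (ψ n) x : ℂ) • φ n := fun x =>
    (hS _ (hA x).1).1
  -- The expansion map is bounded by the two Riesz inequalities and fixes finite combinations, hence
  -- is the identity.
  let J : X →ₗ[ℂ] X :=
    { toFun := fun x => ∑' n, (inner ℂ (ψ n) x : ℂ) • φ n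
      map_add' := fun x y => by
        simp only [inner_add_right, add_smul]
        exact (hsum x).tsum_add (hsum y)
      map_smul' := fun c x => by
        simp only [inner_smul_right, mul_smul, RingHom.id_apply]
        exact (hsum x).tsum_const_smul c }
  have hJ : ∀ x, ‖J x‖ ≤ Real.sqrt (Mb / Ma) * ‖x‖ := fun x => by
    refine le_of_sq_le_sq ?_ (by positivity)
    rw [mul_pow, Real.sq_sqrt (by positivity)]
    calc ‖J x‖ ^ 2 ≤ Mb * ∑' n, ‖inner ℂ (ψ n) x‖ ^ 2 := (hS _ (hA x).1).2
      _ ≤ Mb * (‖x‖ ^ 2 / Ma) := by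
        gcongr
        rw [le_div_iff₀' hMa]
        exact (hA x).2
      _ = _ := by ring
  have hJx : J x = x := by
    refine hb.induction (P := fun x => J x = x)
      (isClosed_eq (J.mkContinuous _ hJ).continuous continuous_id) (fun s a => ?_) x
    change ∑' n, (inner ℂ (ψ n) (∑ n ∈ s, a n • φ n) : ℂ) • φ n = _
    simp only [inner_sum_of_biorthogonal hbi]
    rw [tsum_eq_sum (s := s) (fun n hn => by simp [hn])]
    exact Finset.sum_congr rfl fun n hn => by simp [hn]
  have := (hsum x).hasSum
  rwa [show ∑' n, (inner ℂ (ψ n) x : ℂ) • φ n = x from hJx] at this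

include hb hbi in
theorem ext_inner_of_rieszBasis [CompleteSpace X] {x y : X}
    (h : ∀ n, (inner ℂ (ψ n) x : ℂ) = inner ℂ (ψ n) y) : x = y := by
  have h1 := hasSum_inner_smul hb hbi x
  simp only [h] at h1
  exact h1.unique (hasSum_inner_smul hb hbi y)

include hb hbi in
theorem exists_norm_sq_le_tsum [CompleteSpace X] :
    ∃ Mb : ℝ, 0 < Mb ∧ ∀ x : X, ‖x‖ ^ 2 ≤ Mb * ∑' n, ‖inner ℂ (ψ n) x‖ ^ 2 := by
  obtain ⟨Ma, hMa, hA⟩ := exists_analysis_bound hb hbi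
  obtain ⟨Mb, hMb, hS⟩ := hb.exists_synthesis_bound
  refine ⟨Mb, hMb, fun x => ?_⟩
  have h := (hS _ (hA x).1).2
  rwa [(hasSum_inner_smul hb hbi x).tsum_eq] at h

/-- Bessel inequality for the coefficients of a functional. -/
theorem IsRieszBasis.summable_sq_inner {φ : ℕ → X} (hb : IsRieszBasis φ) (f : X) :
    Summable fun n => ‖inner ℂ f (φ n)‖ ^ 2 := by
  obtain ⟨Ma, Mb, hMa, hMb, H⟩ := hb.exists_bounds
  refine summable_of_sum_le (c := Mb * ‖f‖ ^ 2) (fun _ => by positivity) fun s => ?_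
  set S := ∑ n ∈ s, ‖inner ℂ f (φ n)‖ ^ 2 with hS
  have hS0 : 0 ≤ S := Finset.sum_nonneg fun _ _ => by positivity
  -- Duality: the combination with conjugated coefficients pairs with `f` to give exactly `S`, so
  -- Cauchy–Schwarz yields S² ≤ ‖f‖² · Mb · S.
  have h1 := (H s fun n => starRingEnd ℂ (inner ℂ f (φ n))).2
  set y := ∑ n ∈ s, starRingEnd ℂ (inner ℂ f (φ n)) • φ n with hy
  have h2 : inner ℂ f y = (S : ℂ) := by
    rw [hy, inner_sum, hS, Complex.ofReal_sum]
    refine Finset.sum_congr rfl fun n _ => ?_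
    rw [inner_smul_right, ← Complex.normSq_eq_conj_mul_self, Complex.normSq_eq_norm_sq]
  have h3 : S ≤ ‖f‖ * ‖y‖ := by
    have := norm_inner_le_norm (𝕜 := ℂ) f y
    rwa [h2, Complex.norm_real, Real.norm_of_nonneg hS0] at this
  simp only [RCLike.norm_conj] at h1
  have h4 : S * S ≤ (Mb * ‖f‖ ^ 2) * S := by
    calc S * S ≤ (‖f‖ * ‖y‖) * (‖f‖ * ‖y‖) := by gcongr
      _ = ‖f‖ ^ 2 * ‖y‖ ^ 2 := by ring
      _ ≤ ‖f‖ ^ 2 * (Mb * S) := by gcongr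
      _ = _ := by ring
  rcases hS0.eq_or_lt with h0 | h0
  · rw [← h0]; positivity
  · exact le_of_mul_le_mul_right h4 h0

end RieszBasis

/-! ### Parseval's identity for vector-valued Fourier series. -/

section Parseval

variable {X : Type*} [NormedAddCommGroup X] [InnerProductSpace ℂ X] [CompleteSpace X]

theorem integral_exp_nat_sub_nat (k l : ℕ) :
    ∫ θ in (0 : ℝ)..2 * Real.pi,
      starRingEnd ℂ (Complex.exp (θ * Complex.I) ^ l) * Complex.exp (θ * Complex.I) ^ k =
      if k = l then 2 * (Real.pi : ℂ) else 0 := by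
  have h : ∀ θ : ℝ, starRingEnd ℂ (Complex.exp (θ * Complex.I) ^ l) *
      Complex.exp (θ * Complex.I) ^ k = Complex.exp ((((k : ℂ) - l) * Complex.I) * θ) := by
    intro θ
    rw [map_pow, ← Complex.exp_conj, ← Complex.exp_nat_mul, ← Complex.exp_nat_mul,
      ← Complex.exp_add]
    congr 1
    simp
    ring
  simp only [h]
  split_ifs with hkl
  · subst hkl
    simp
  · have h0 : (k : ℂ) - l ≠ 0 := by
      rw [sub_ne_zero]
      exact_mod_cast hkl
    rw [integral_exp_mul_complex (mul_ne_zero h0 Complex.I_ne_zero)]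
    have h1 : ((k : ℂ) - l) * Complex.I * ((2 * Real.pi : ℝ) : ℂ) =
        ((k - l : ℤ) : ℂ) * (2 * Real.pi * Complex.I) := by
      push_cast
      ring
    rw [h1, Complex.exp_int_mul_two_pi_mul_I]
    simp

/-- Parseval's identity for absolutely convergent vector-valued Fourier series. -/
theorem hasSum_integral_norm_sq {a : ℕ → X} (ha : Summable fun k => ‖a k‖) :
    HasSum (fun k => 2 * Real.pi * ‖a k‖ ^ 2)
      (∫ θ in (0 : ℝ)..2 * Real.pi, ‖∑' k, Complex.exp (θ * Complex.I) ^ k • a k‖ ^ 2) := by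
  set e : ℝ → ℂ := fun θ => Complex.exp (θ * Complex.I) with he
  have hec : Continuous e := by fun_prop
  have hen : ∀ θ k, ‖e θ ^ k‖ = 1 := fun θ k => by
    rw [norm_pow, he, Complex.norm_exp_ofReal_mul_I, one_pow]
  set g : ℝ → X := fun θ => ∑' k, e θ ^ k • a k with hg
  have hgs : ∀ θ, HasSum (fun k => e θ ^ k • a k) (g θ) := fun θ =>
    (Summable.of_norm (by simpa [norm_smul, hen] using ha)).hasSum
  have hgc : Continuous g := continuous_tsum (fun k => by fun_prop) ha
    fun k θ => by rw [norm_smul, hen, one_mul]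
  have hgb : ∀ θ, ‖g θ‖ ≤ ∑' k, ‖a k‖ := fun θ =>
    tsum_of_norm_bounded ha.hasSum fun k => by rw [norm_smul, hen, one_mul]
  have hcoef : ∀ l, ∫ θ in (0 : ℝ)..2 * Real.pi, starRingEnd ℂ (e θ ^ l) • g θ =
      (2 * (Real.pi : ℂ)) • a l := by
    intro l
    have h1 := intervalIntegral.hasSum_integral_of_dominated_convergence
      (μ := MeasureTheory.volume) (a := 0) (b := 2 * Real.pi)
      (F := fun k θ => (starRingEnd ℂ (e θ ^ l) * e θ ^ k) • a k)
      (f := fun θ => starRingEnd ℂ (e θ ^ l) • g θ)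
      (fun k _ => ‖a k‖)
      (fun k => (Continuous.aestronglyMeasurable (by fun_prop)))
      (fun k => Eventually.of_forall fun θ _ => by
        rw [norm_smul, norm_mul, RCLike.norm_conj, hen, hen]; simp)
      (Eventually.of_forall fun _ _ => ha) (by simp)
      (Eventually.of_forall fun θ _ => by
        simpa only [mul_smul] using (hgs θ).const_smul (starRingEnd ℂ (e θ ^ l)))
    refine h1.unique ?_
    have h2 : (fun k => ∫ θ in (0 : ℝ)..2 * Real.pi, (starRingEnd ℂ (e θ ^ l) * e θ ^ k) • a k) =
        fun k => if k = l then (2 * (Real.pi : ℂ)) • a l else 0 := by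
      ext k
      rw [intervalIntegral.integral_smul_const, integral_exp_nat_sub_nat]
      split_ifs with h
      · rw [h]
      · simp
    rw [h2]
    exact hasSum_ite_eq l _
  -- Only one factor of ⟨g, g⟩ is expanded; integrating termwise leaves the Fourier coefficients of
  -- `g`, known from `hcoef`.
  have h3 := intervalIntegral.hasSum_integral_of_dominated_convergence
      (μ := MeasureTheory.volume) (a := 0) (b := 2 * Real.pi)
      (F := fun l θ => (inner ℂ (a l) (starRingEnd ℂ (e θ ^ l) • g θ) : ℂ))
      (f := fun θ => ((‖g θ‖ ^ 2 : ℝ) : ℂ))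
      (fun l _ => ‖a l‖ * ∑' k, ‖a k‖)
      (fun k => (Continuous.aestronglyMeasurable (by fun_prop)))
      (fun l => Eventually.of_forall fun θ _ => by
        refine (norm_inner_le_norm _ _).trans ?_
        rw [norm_smul, RCLike.norm_conj, hen, one_mul]
        exact mul_le_mul_of_nonneg_left (hgb θ) (norm_nonneg _))
      (Eventually.of_forall fun _ _ => ha.mul_right _) (by simp)
      (Eventually.of_forall fun θ _ => by
        have h4 := (innerSL ℂ (g θ)).hasSum (hgs θ)
        have h5 := Complex.hasSum_conj'.2 h4
        simp only [innerSL_apply_apply, inner_conj_symm, inner_self_eq_norm_sq_to_K] at h5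
        have h7 : ((‖g θ‖ ^ 2 : ℝ) : ℂ) = starRingEnd ℂ ((‖g θ‖ : ℂ) ^ 2) := by simp
        rw [h7]
        refine (congrArg (HasSum · _) (funext fun l => ?_)).mp h5
        rw [inner_smul_left, inner_smul_right])
  rw [intervalIntegral.integral_ofReal] at h3
  rw [← Complex.hasSum_ofReal]
  refine (congrArg (HasSum · _) (funext fun l => ?_)).mp h3
  have h6 := (innerSL ℂ (a l)).intervalIntegral_comp_comm
    (f := fun θ => starRingEnd ℂ (e θ ^ l) • g θ) (μ := MeasureTheory.volume)
    (a := 0) (b := 2 * Real.pi) (Continuous.intervalIntegrable (by fun_prop) _ _)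
  simp only [innerSL_apply_apply] at h6
  rw [h6, hcoef, inner_smul_right, inner_self_eq_norm_sq_to_K]
  push_cast
  rfl

end Parseval

/-! ### Power boundedness from Abel means of resolvents. -/

section PowerBounded

variable {X : Type*} [NormedAddCommGroup X] [InnerProductSpace ℂ X] [CompleteSpace X]

/-- Invertibility on the open disc puts the spectral radius at most 1. Gelfand's formula then gives
‖D^k‖ ≤ s^k eventually for some s > 1 with s r < 1, and a geometric series dominates. -/
theorem summable_pow_mul_norm_pow {D : X →L[ℂ] X}
    (hD : ∀ w : ℂ, ‖w‖ < 1 → IsUnit (1 - w • D)) {r : ℝ} (hr0 : 0 ≤ r) (hr : r < 1) :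
    Summable fun k : ℕ => r ^ k * ‖D ^ k‖ := by
  have hsr : spectralRadius ℂ D ≤ 1 := by
    refine iSup₂_le fun z hz => ?_
    by_contra! hlt
    have h1 : 1 < ‖z‖ := by
      have : (1 : NNReal) < ‖z‖₊ := by exact_mod_cast hlt
      exact_mod_cast this
    have hz0 : z ≠ 0 := norm_pos_iff.1 (by linarith)
    refine hz ?_
    have h2 := hD z⁻¹ (by rw [norm_inv]; exact inv_lt_one_of_one_lt₀ h1)
    have h3 : algebraMap ℂ (X →L[ℂ] X) z - D = (algebraMap ℂ (X →L[ℂ] X) z) * (1 - z⁻¹ • D) := by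
      rw [mul_sub, mul_one, Algebra.algebraMap_eq_smul_one, smul_mul_assoc, one_mul,
        smul_inv_smul₀ hz0]
    rw [_root_.resolventSet, Set.mem_ofPred_eq, h3]
    exact ((isUnit_iff_ne_zero.2 hz0).map (algebraMap ℂ (X →L[ℂ] X))).mul h2
  obtain ⟨s, hs1, hsr1⟩ : ∃ s : ℝ, 1 < s ∧ s * r < 1 := by
    rcases hr0.eq_or_lt with rfl | h
    · exact ⟨2, by norm_num, by norm_num⟩
    · obtain ⟨s, hs, hs'⟩ := exists_between (one_lt_inv_iff₀.2 ⟨h, hr⟩)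
      exact ⟨s, hs, by rwa [← lt_div_iff₀ h, one_div]⟩
  have hg := spectrum.pow_norm_pow_one_div_tendsto_nhds_spectralRadius D
  have hev : ∀ᶠ k : ℕ in atTop, ‖D ^ k‖ ≤ s ^ k := by
    have h1 : spectralRadius ℂ D < ENNReal.ofReal s :=
      hsr.trans_lt (by rw [← ENNReal.ofReal_one]; exact (ENNReal.ofReal_lt_ofReal_iff (by linarith)).2 hs1)
    filter_upwards [hg.eventually_lt_const h1, eventually_gt_atTop 0] with k hk hk0
    have h2 := (ENNReal.ofReal_lt_ofReal_iff (by linarith)).1 hk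
    have h3 := pow_le_pow_left₀ (by positivity) h2.le k
    rwa [← Real.rpow_natCast (‖D ^ k‖ ^ (1 / k : ℝ)), ← Real.rpow_mul (norm_nonneg _),
      one_div_mul_cancel (by positivity), Real.rpow_one] at h3
  refine Summable.of_norm_bounded_eventually_nat
    (summable_geometric_of_lt_one (by positivity) hsr1) ?_
  filter_upwards [hev] with k hk
  rw [Real.norm_of_nonneg (by positivity), mul_pow, mul_comm]
  gcongr

/-- Parseval's identity for the resolvent on a circle. -/
theorem hasSum_integral_inverse_one_sub {D : X →L[ℂ] X} {r : ℝ} (hr0 : 0 ≤ r)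
    (hD : Summable fun k : ℕ => r ^ k * ‖D ^ k‖) (x : X) :
    HasSum (fun k : ℕ => 2 * Real.pi * (r ^ k * ‖(D ^ k) x‖) ^ 2)
      (∫ θ in (0 : ℝ)..2 * Real.pi,
        ‖Ring.inverse (1 - ((r : ℂ) * Complex.exp (θ * Complex.I)) • D) x‖ ^ 2) := by
  have hn : ∀ k : ℕ, ‖((r : ℂ) ^ k) • (D ^ k) x‖ = r ^ k * ‖(D ^ k) x‖ := fun k => by
    rw [norm_smul, norm_pow, Complex.norm_real, Real.norm_of_nonneg hr0]
  have ha : Summable fun k : ℕ => ‖((r : ℂ) ^ k) • (D ^ k) x‖ := by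
    refine Summable.of_nonneg_of_le (fun _ => norm_nonneg _) (fun k => ?_) (hD.mul_right ‖x‖)
    rw [hn, mul_assoc]
    gcongr
    exact (D ^ k).le_opNorm x
  have h := hasSum_integral_norm_sq ha
  simp only [hn] at h
  convert h using 3 with θ
  set w : ℂ := (r : ℂ) * Complex.exp (θ * Complex.I) with hw
  have hwn : ‖w‖ = r := by
    rw [hw, norm_mul, Complex.norm_exp_ofReal_mul_I, mul_one, Complex.norm_real,
      Real.norm_of_nonneg hr0]
  have hs : Summable fun k : ℕ => (w • D) ^ k := by
    refine Summable.of_norm (hD.congr fun k => ?_)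
    rw [smul_pow, norm_smul, norm_pow w, hwn]
  have hinv : Ring.inverse (1 - w • D) = ∑' k : ℕ, (w • D) ^ k := by
    let U : (X →L[ℂ] X)ˣ := ⟨1 - w • D, ∑' k : ℕ, (w • D) ^ k,
      hs.one_sub_mul_tsum_pow, hs.tsum_pow_mul_one_sub⟩
    exact Ring.inverse_unit U
  rw [hinv]
  have h1 := ((ContinuousLinearMap.apply ℂ X x).hasSum hs.hasSum).tsum_eq
  simp only [ContinuousLinearMap.apply_apply] at h1
  rw [← h1]
  congr 2
  refine tsum_congr fun k => ?_
  rw [smul_pow, smul_apply, hw, mul_pow, mul_comm, mul_smul]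

theorem continuous_inverse_one_sub {D : X →L[ℂ] X} {r : ℝ}
    (hD : ∀ w : ℂ, ‖w‖ < 1 → IsUnit (1 - w • D)) (hr0 : 0 ≤ r) (hr : r < 1) (x : X) :
    Continuous fun θ : ℝ =>
      Ring.inverse (1 - ((r : ℂ) * Complex.exp (θ * Complex.I)) • D) x := by
  have : Continuous fun θ : ℝ =>
      Ring.inverse (1 - ((r : ℂ) * Complex.exp (θ * Complex.I)) • D) := by
    rw [continuous_iff_continuousAt]
    intro θ
    obtain ⟨U, hU⟩ := hD ((r : ℂ) * Complex.exp (θ * Complex.I)) (by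
      rwa [norm_mul, Complex.norm_exp_ofReal_mul_I, mul_one, Complex.norm_real,
        Real.norm_of_nonneg hr0])
    refine ContinuousAt.comp (f := fun θ : ℝ => 1 - ((r : ℂ) * Complex.exp (θ * Complex.I)) • D)
      (g := Ring.inverse) ?_ (Continuous.continuousAt (by fun_prop))
    rw [← hU]
    exact NormedRing.inverse_continuousAt U
  exact this.clm_apply continuous_const

/-- A discrete-time Abel-mean criterion for power boundedness on a Hilbert space. -/
theorem powerBounded_of_abel_bounds {D : X →L[ℂ] X} {C : ℝ} (hC0 : 0 ≤ C)
    (h1 : ∀ r : ℝ, 0 ≤ r → r < 1 → ∀ (n : ℕ) (x : X),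
      (1 - r ^ 2) * ∑ k ∈ Finset.range n, (r ^ k * ‖(D ^ k) x‖) ^ 2 ≤ C * ‖x‖ ^ 2)
    (h2 : ∀ r : ℝ, 0 ≤ r → r < 1 → ∀ (n : ℕ) (x : X),
      (1 - r ^ 2) * ∑ k ∈ Finset.range n, (r ^ k * ‖(D.adjoint ^ k) x‖) ^ 2 ≤ C * ‖x‖ ^ 2) :
    PowerBounded D := by
  have cesaro : ∀ E : X →L[ℂ] X, (∀ r : ℝ, 0 ≤ r → r < 1 → ∀ (n : ℕ) (x : X),
      (1 - r ^ 2) * ∑ k ∈ Finset.range n, (r ^ k * ‖(E ^ k) x‖) ^ 2 ≤ C * ‖x‖ ^ 2) →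
      ∀ (n : ℕ) (x : X), ∑ k ∈ Finset.range (n + 1), ‖(E ^ k) x‖ ^ 2 ≤
        6 * C * (n + 1) * ‖x‖ ^ 2 := by
    intro E hE n x
    -- The Abel bound is used at r² = q. There q^k ≥ 1/3 for k ≤ n because (1 + 1/(n+1))^{n+1} ≤ e ≤
    -- 3, and 1 - q = 1/(n+2). The constant 6 is 3 times the 2 in n + 2 ≤ 2(n + 1).
    set q : ℝ := (1 + 1 / ((n : ℝ) + 1))⁻¹ with hq
    have hq0 : 0 < q := by positivity
    have hq1 : q < 1 := inv_lt_one_of_one_lt₀ (by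
      have : 0 < 1 / ((n : ℝ) + 1) := by positivity
      linarith)
    have hqk : ∀ k ∈ Finset.range (n + 1), 1 / 3 ≤ q ^ k := by
      intro k hk
      have hk' : k ≤ n + 1 := (Finset.mem_range.1 hk).le
      refine le_trans ?_ (pow_le_pow_of_le_one hq0.le hq1.le hk')
      rw [hq, inv_pow, one_div]
      gcongr
      calc (1 + 1 / ((n : ℝ) + 1)) ^ (n + 1) ≤ Real.exp (1 / ((n : ℝ) + 1)) ^ (n + 1) := by
            gcongr
            linarith [Real.add_one_le_exp (1 / ((n : ℝ) + 1))]
        _ = Real.exp 1 := by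
            rw [← Real.exp_nat_mul]
            congr 1
            push_cast
            field_simp
        _ ≤ 3 := by linarith [Real.exp_one_lt_d9]
    have h3 := hE (Real.sqrt q) (Real.sqrt_nonneg q)
      ((Real.sqrt_lt_sqrt hq0.le hq1).trans_eq Real.sqrt_one) (n + 1) x
    have h4 : ∀ k : ℕ, (Real.sqrt q ^ k * ‖(E ^ k) x‖) ^ 2 = q ^ k * ‖(E ^ k) x‖ ^ 2 := fun k => by
      rw [mul_pow, ← pow_mul, mul_comm k 2, pow_mul, Real.sq_sqrt hq0.le]
    simp only [h4, Real.sq_sqrt hq0.le] at h3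
    have h5 : 1 / 3 * ∑ k ∈ Finset.range (n + 1), ‖(E ^ k) x‖ ^ 2 ≤
        ∑ k ∈ Finset.range (n + 1), q ^ k * ‖(E ^ k) x‖ ^ 2 := by
      rw [Finset.mul_sum]
      exact Finset.sum_le_sum fun k hk => mul_le_mul_of_nonneg_right (hqk k hk) (by positivity)
    have h6 : 1 - q = 1 / ((n : ℝ) + 2) := by
      rw [hq]
      field_simp
      ring
    rw [h6, one_div, inv_mul_le_iff₀ (by positivity)] at h3
    have h7 : (n : ℝ) + 2 ≤ 2 * (n + 1) := by
      have : (0 : ℝ) ≤ n := by positivity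
      linarith
    have h8 : ((n : ℝ) + 2) * (C * ‖x‖ ^ 2) ≤ (2 * (n + 1)) * (C * ‖x‖ ^ 2) := by gcongr
    linarith
  refine ⟨6 * C, fun n => ContinuousLinearMap.opNorm_le_bound _ (by positivity) fun x => ?_⟩
  set y := (D ^ n) x with hy
  -- ‖Dⁿx‖² equals the inner product of D^k x with (D*)^{n-k} y for each k ≤ n. Summing the n + 1
  -- identities and applying Cauchy–Schwarz, the factors n + 1 of the two Cesàro bounds cancel.
  have hadj : ∀ k ≤ n, ‖y‖ ^ 2 ≤ ‖(D ^ k) x‖ * ‖(D.adjoint ^ (n - k)) y‖ := by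
    intro k hk
    have e1 : (D ^ n) x = (D ^ (n - k)) ((D ^ k) x) := by
      rw [← mul_apply_eq_comp, ← pow_add, Nat.sub_add_cancel hk]
    have e2 : D.adjoint ^ (n - k) = (D ^ (n - k)).adjoint := by
      rw [← ContinuousLinearMap.star_eq_adjoint, ← ContinuousLinearMap.star_eq_adjoint, star_pow]
    have e3 : (inner ℂ ((D.adjoint ^ (n - k)) y) ((D ^ k) x) : ℂ) = (‖y‖ : ℂ) ^ 2 := by
      rw [e2, ContinuousLinearMap.adjoint_inner_left, ← e1, ← hy, inner_self_eq_norm_sq_to_K]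
      rfl
    have e4 := norm_inner_le_norm (𝕜 := ℂ) ((D.adjoint ^ (n - k)) y) ((D ^ k) x)
    rw [e3, norm_pow, Complex.norm_real, norm_norm] at e4
    linarith
  have hsum : ((n : ℝ) + 1) * ‖y‖ ^ 2 ≤
      ∑ k ∈ Finset.range (n + 1), ‖(D ^ k) x‖ * ‖(D.adjoint ^ (n - k)) y‖ := by
    have := Finset.sum_le_sum fun k (hk : k ∈ Finset.range (n + 1)) =>
      hadj k (Nat.lt_succ_iff.1 (Finset.mem_range.1 hk))
    simpa using this
  have hcs := Finset.sum_mul_sq_le_sq_mul_sq (Finset.range (n + 1)) (fun k => ‖(D ^ k) x‖)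
    fun k => ‖(D.adjoint ^ (n - k)) y‖
  have hrefl : ∑ k ∈ Finset.range (n + 1), ‖(D.adjoint ^ (n - k)) y‖ ^ 2 =
      ∑ k ∈ Finset.range (n + 1), ‖(D.adjoint ^ k) y‖ ^ 2 := by
    rw [← Finset.sum_range_reflect]
    refine Finset.sum_congr rfl fun k hk => ?_
    have := Finset.mem_range.1 hk
    congr 4
    omega
  rw [hrefl] at hcs
  have hb : (((n : ℝ) + 1) * ‖y‖ ^ 2) ^ 2 ≤
      (6 * C * (n + 1) * ‖x‖ ^ 2) * (6 * C * (n + 1) * ‖y‖ ^ 2) :=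
    (pow_le_pow_left₀ (by positivity) hsum 2).trans (hcs.trans (mul_le_mul (cesaro D h1 n x)
      (cesaro D.adjoint h2 n y) (Finset.sum_nonneg fun _ _ => by positivity) (by positivity)))
  rcases (norm_nonneg y).eq_or_lt with h0 | h0
  · rw [← h0]
    positivity
  · refine le_of_sq_le_sq ?_ (by positivity)
    have hpos : 0 < ((n : ℝ) + 1) ^ 2 * ‖y‖ ^ 2 := by positivity
    refine le_of_mul_le_mul_left ?_ hpos
    calc _ = (((n : ℝ) + 1) * ‖y‖ ^ 2) ^ 2 := by ring
      _ ≤ _ := hb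
      _ = _ := by ring

/-- Pointwise domination of resolvents transfers Abel bounds. -/
theorem abel_bound_of_norm_inverse_le {ι : Type*} [Fintype ι] {E T : X →L[ℂ] X} {M C : ℝ}
    (hT : ∀ k : ℕ, ‖T ^ k‖ ≤ M) (hTu : ∀ w : ℂ, ‖w‖ < 1 → IsUnit (1 - w • T))
    (hE : ∀ w : ℂ, ‖w‖ < 1 → IsUnit (1 - w • E)) (x : X) (y : ι → X)
    (h : ∀ w : ℂ, ‖w‖ < 1 →
      ‖Ring.inverse (1 - w • E) x‖ ≤ C * ∑ j, ‖Ring.inverse (1 - w • T) (y j)‖)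
    {r : ℝ} (hr0 : 0 ≤ r) (hr : r < 1) (n : ℕ) :
    (1 - r ^ 2) * ∑ k ∈ Finset.range n, (r ^ k * ‖(E ^ k) x‖) ^ 2 ≤
      C ^ 2 * Fintype.card ι * M ^ 2 * ∑ j, ‖y j‖ ^ 2 := by
  have hr2 : r ^ 2 < 1 := by nlinarith
  have hM : 0 ≤ M := (norm_nonneg _).trans (hT 0)
  have hEs := hasSum_integral_inverse_one_sub hr0 (summable_pow_mul_norm_pow hE hr0 hr) x
  have hTs := fun j =>
    hasSum_integral_inverse_one_sub hr0 (summable_pow_mul_norm_pow hTu hr0 hr) (y j)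
  have hpi := Real.pi_pos
  have hTb : ∀ j, (∫ θ in (0 : ℝ)..2 * Real.pi,
      ‖Ring.inverse (1 - ((r : ℂ) * Complex.exp (θ * Complex.I)) • T) (y j)‖ ^ 2) ≤
      2 * Real.pi * ((M * ‖y j‖) ^ 2 * (1 - r ^ 2)⁻¹) := fun j => by
    refine hasSum_le (fun k => ?_) (hTs j)
      (((hasSum_geometric_of_lt_one (by positivity) hr2).mul_left _).mul_left _)
    have : ‖(T ^ k) (y j)‖ ≤ M * ‖y j‖ := (T ^ k).le_of_opNorm_le (hT k) (y j)
    calc 2 * Real.pi * (r ^ k * ‖(T ^ k) (y j)‖) ^ 2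
        ≤ 2 * Real.pi * (r ^ k * (M * ‖y j‖)) ^ 2 := by gcongr
      _ = _ := by ring
  -- The pointwise bound is squared; Cauchy–Schwarz over `j` costs the cardinality of `ι`.
  have hint : (∫ θ in (0 : ℝ)..2 * Real.pi,
      ‖Ring.inverse (1 - ((r : ℂ) * Complex.exp (θ * Complex.I)) • E) x‖ ^ 2) ≤
      C ^ 2 * Fintype.card ι * ∑ j, ∫ θ in (0 : ℝ)..2 * Real.pi,
        ‖Ring.inverse (1 - ((r : ℂ) * Complex.exp (θ * Complex.I)) • T) (y j)‖ ^ 2 := by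
    have hc := continuous_inverse_one_sub hE hr0 hr x
    have hcT := fun j => continuous_inverse_one_sub hTu hr0 hr (y j)
    rw [← intervalIntegral.integral_finsetSum (f := fun j (θ : ℝ) =>
      ‖Ring.inverse (1 - ((r : ℂ) * Complex.exp (θ * Complex.I)) • T) (y j)‖ ^ 2) fun j _ =>
      Continuous.intervalIntegrable ((hcT j).norm.pow 2) _ _, ← intervalIntegral.integral_const_mul]
    refine intervalIntegral.integral_mono (by positivity) ((hc.norm.pow 2).intervalIntegrable _ _)
      (Continuous.intervalIntegrable (continuous_const.mul
        (continuous_finsetSum _ fun j _ => (hcT j).norm.pow 2)) _ _) fun θ => ?_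
    have h1 := h ((r : ℂ) * Complex.exp (θ * Complex.I)) (by
      rwa [norm_mul, Complex.norm_exp_ofReal_mul_I, mul_one, Complex.norm_real,
        Real.norm_of_nonneg hr0])
    refine (pow_le_pow_left₀ (norm_nonneg _) h1 2).trans ?_
    rw [mul_pow, mul_assoc]
    gcongr
    simpa using sq_sum_le_card_mul_sum_sq (s := Finset.univ)
      (f := fun j => ‖Ring.inverse (1 - ((r : ℂ) * Complex.exp (θ * Complex.I)) • T) (y j)‖)
  have hfin : 2 * Real.pi * ∑ k ∈ Finset.range n, (r ^ k * ‖(E ^ k) x‖) ^ 2 ≤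
      2 * Real.pi * (C ^ 2 * Fintype.card ι * ∑ j, ((M * ‖y j‖) ^ 2 * (1 - r ^ 2)⁻¹)) := by
    rw [Finset.mul_sum]
    refine (sum_le_hasSum _ (fun k _ => by positivity) hEs).trans (hint.trans ?_)
    calc _ ≤ C ^ 2 * Fintype.card ι *
          ∑ j, 2 * Real.pi * ((M * ‖y j‖) ^ 2 * (1 - r ^ 2)⁻¹) := by
          gcongr with j
          exact hTb j
      _ = _ := by
          rw [← Finset.mul_sum]
          ring
  have hfin2 := le_of_mul_le_mul_left hfin (by positivity)
  calc _ ≤ (1 - r ^ 2) * (C ^ 2 * Fintype.card ι * ∑ j, ((M * ‖y j‖) ^ 2 * (1 - r ^ 2)⁻¹)) :=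
        mul_le_mul_of_nonneg_left hfin2 (by linarith)
    _ = _ := by
        rw [← Finset.sum_mul]
        simp only [mul_pow]
        rw [← Finset.mul_sum]
        have : 1 - r ^ 2 ≠ 0 := by linarith
        field_simp

end PowerBounded

/-! ### Finite-rank perturbations of power bounded operators. -/

section FiniteRank

variable {X : Type*} [NormedAddCommGroup X] [InnerProductSpace ℂ X]

/-- The finite-rank operator `x ↦ ∑ i, ⟨v i, x⟩ u i`. -/
noncomputable def finiteRank {ι : Type*} [Fintype ι] (v u : ι → X) : X →L[ℂ] X :=
  ∑ i, (innerSL ℂ (v i)).smulRight (u i)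

variable {ι : Type*} [Fintype ι]

theorem finiteRank_apply (v u : ι → X) (x : X) :
    finiteRank v u x = ∑ i, (inner ℂ (v i) x : ℂ) • u i := by
  simp [finiteRank]

/-- Fredholm alternative: a finite-rank operator is compact, so 1 is either an eigenvalue or in the
resolvent set. -/
theorem isUnit_one_sub_finiteRank [CompleteSpace X] {v u : ι → X}
    (h : ∀ x, x = ∑ i, (inner ℂ (v i) x : ℂ) • u i → x = 0) :
    IsUnit (1 - finiteRank v u) := by
  have hc : IsCompactOperator (finiteRank v u) := by
    have : ∀ s : Finset ι, IsCompactOperator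
        (∑ i ∈ s, (innerSL ℂ (v i)).smulRight (u i) : X →L[ℂ] X) := by
      classical
      intro s
      induction s using Finset.induction_on with
      | empty => simpa using isCompactOperator_zero
      | insert i s hi ih =>
        rw [Finset.sum_insert hi]
        refine IsCompactOperator.add (f := ((innerSL ℂ (v i)).smulRight (u i) : X →L[ℂ] X)) ?_ ih
        exact (isCompactOperator_of_locallyCompactSpace_dom (innerSL ℂ (v i))).clm_comp
          (ContinuousLinearMap.toSpanSingleton ℂ (u i))
    exact this _
  rcases hc.hasEigenvalue_or_mem_resolventSet one_ne_zero with he | hr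
  · obtain ⟨x, hx⟩ := he.exists_hasEigenvector
    refine absurd (h x ?_) hx.2
    have h1 := hx.apply_eq_smul
    rw [one_smul] at h1
    rw [← finiteRank_apply]
    exact h1.symm
  · simpa [_root_.resolventSet] using hr

theorem continuousOn_finiteRank {v : ι → X} {k : ι → ℂ → X} {s : Set ℂ}
    (hk : ∀ i, ContinuousOn (k i) s) : ContinuousOn (fun w => finiteRank v fun i => k i w) s := by
  refine continuousOn_finsetSum _ fun i _ => ?_
  exact (ContinuousLinearMap.smulRightL ℂ X X (innerSL ℂ (v i))).continuous.comp_continuousOn (hk i)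

/-- Power boundedness of a finite-rank perturbation, provided the perturbation problem is uniquely
solvable up to the boundary of the unit disc. -/
theorem powerBounded_add_finiteRank [CompleteSpace X] {T : X →L[ℂ] X} {M : ℝ} (hT : ∀ k : ℕ, ‖T ^ k‖ ≤ M)
    (v u : ι → X) (k : ι → ℂ → X) (hk : ∀ i, ContinuousOn (k i) (Metric.closedBall 0 1))
    (hku : ∀ i (w : ℂ), ‖w‖ ≤ 1 → (1 - w • T) (k i w) = w • u i)
    (hinj : ∀ w : ℂ, ‖w‖ ≤ 1 → ∀ x, x = ∑ i, (inner ℂ (v i) x : ℂ) • k i w → x = 0) :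
    PowerBounded (T + finiteRank v u) := by
  set D := T + finiteRank v u with hD
  have hM : 0 ≤ M := (norm_nonneg _).trans (hT 0)
  have hTu : ∀ w : ℂ, ‖w‖ < 1 → IsUnit (1 - w • T) := fun w hw => by
    have hs : Summable fun k : ℕ => (w • T) ^ k := by
      refine Summable.of_norm_bounded
        ((summable_geometric_of_lt_one (norm_nonneg w) hw).mul_right M) fun k => ?_
      rw [smul_pow, norm_smul, norm_pow w]
      gcongr
      exact hT k
    exact ⟨⟨1 - w • T, ∑' k : ℕ, (w • T) ^ k,
      hs.one_sub_mul_tsum_pow, hs.tsum_pow_mul_one_sub⟩, rfl⟩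
  set N : ℂ → X →L[ℂ] X := fun w => 1 - finiteRank v fun i => k i w with hN
  have hNu : ∀ w : ℂ, ‖w‖ ≤ 1 → IsUnit (N w) := fun w hw => isUnit_one_sub_finiteRank (hinj w hw)
  -- `k i w` stands for (1 - wT)⁻¹(w u_i), also on the unit circle, where 1 - wT need not be
  -- invertible; only the equation `hku` is needed.
  have hfac : ∀ w : ℂ, ‖w‖ ≤ 1 → 1 - w • D = (1 - w • T) * N w := fun w hw => by
    ext x
    rw [mul_apply_eq_comp, hN]
    simp only [sub_apply, one_apply_eq_self, smul_apply, hD, add_apply, map_sub]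
    rw [finiteRank_apply, finiteRank_apply, map_sum]
    have : ∀ i, T ((inner ℂ (v i) x : ℂ) • k i w) = (inner ℂ (v i) x : ℂ) • T (k i w) :=
      fun i => map_smul _ _ _
    have h2 : ∀ i, k i w - w • T (k i w) = w • u i := fun i => by simpa using hku i w hw
    have h3 : ∑ i, (inner ℂ (v i) x : ℂ) • k i w - w • ∑ i, T ((inner ℂ (v i) x : ℂ) • k i w) =
        w • ∑ i, (inner ℂ (v i) x : ℂ) • u i := by
      rw [Finset.smul_sum, Finset.smul_sum, ← Finset.sum_sub_distrib]
      refine Finset.sum_congr rfl fun i _ => ?_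
      rw [this, smul_comm w, smul_comm w, ← smul_sub, h2]
    rw [smul_add, ← h3]
    simp only [Finset.smul_sum]
    abel
  have hDu : ∀ w : ℂ, ‖w‖ < 1 → IsUnit (1 - w • D) := fun w hw => by
    rw [hfac w hw.le]
    exact (hTu w hw).mul (hNu w hw.le)
  -- Inversion is continuous on units, so the inverse of `N w` is bounded on the compact disc.
  obtain ⟨C, hC⟩ : ∃ C, ∀ w ∈ Metric.closedBall (0 : ℂ) 1, ‖Ring.inverse (N w)‖ ≤ C := by
    refine (isCompact_closedBall _ _).exists_bound_of_continuousOn fun w hw => ?_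
    obtain ⟨U, hU⟩ := hNu w (by simpa using hw)
    have h1 : ContinuousWithinAt N (Metric.closedBall 0 1) w :=
      (continuousOn_const.sub (continuousOn_finiteRank hk)) w hw
    have h2 := NormedRing.inverse_continuousAt U
    rw [hU] at h2
    exact ContinuousAt.comp_continuousWithinAt (f := N) h2 h1
  have hC0 : 0 ≤ C := (norm_nonneg _).trans (hC 0 (by simp))
  obtain ⟨L, hL0, hL⟩ : ∃ L, 0 ≤ L ∧ ∀ i, ∀ w ∈ Metric.closedBall (0 : ℂ) 1, ‖k i w‖ ≤ L := by
    choose L hL using fun i => (isCompact_closedBall (0 : ℂ) 1).exists_bound_of_continuousOn (hk i)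
    have hL0 : ∀ i, 0 ≤ L i := fun i => (norm_nonneg _).trans (hL i 0 (by simp))
    exact ⟨∑ i, L i, Finset.sum_nonneg fun i _ => hL0 i, fun i w hw => (hL i w hw).trans
      (Finset.single_le_sum (fun i _ => hL0 i) (Finset.mem_univ i))⟩
  have hinv : ∀ w : ℂ, ‖w‖ < 1 →
      Ring.inverse (1 - w • D) = Ring.inverse (N w) * Ring.inverse (1 - w • T) := fun w hw => by
    obtain ⟨U, hU⟩ := hTu w hw
    obtain ⟨V, hV⟩ := hNu w hw.le
    rw [hfac w hw.le, ← hU, ← hV, ← Units.val_mul, Ring.inverse_unit, Ring.inverse_unit,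
      Ring.inverse_unit, mul_inv_rev, Units.val_mul]
  have hfwd : ∀ w : ℂ, ‖w‖ < 1 → ∀ x,
      ‖Ring.inverse (1 - w • D) x‖ ≤ C * ‖Ring.inverse (1 - w • T) x‖ := fun w hw x => by
    rw [hinv w hw, mul_apply_eq_comp]
    exact ContinuousLinearMap.le_of_opNorm_le _ (hC w (by simpa using hw.le)) _
  have hu : ∀ w : ℂ, ‖w‖ < 1 → ∀ i, ‖Ring.inverse (1 - w • D) (w • u i)‖ ≤ C * L :=
    fun w hw i => by
    rw [hinv w hw, mul_apply_eq_comp, ← hku i w hw.le,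
      ← mul_apply_eq_comp (Ring.inverse (1 - w • T)),
      Ring.inverse_mul_cancel _ (hTu w hw), one_apply_eq_self]
    exact (ContinuousLinearMap.le_of_opNorm_le _ (hC w (by simpa using hw.le)) _).trans
      (mul_le_mul_of_nonneg_left (hL i w (by simpa using hw.le)) hC0)
  -- For the adjoint the factorization has the inverse of N(w) on the wrong side: its adjoint acts
  -- first on `y`. The second resolvent identity is used instead, written so that the resolvent of
  -- `D` meets only the vectors w u_i, where `hu` bounds it.
  have hres : ∀ w : ℂ, ‖w‖ < 1 → ∀ x, Ring.inverse (1 - w • D) x = Ring.inverse (1 - w • T) x +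
      ∑ i, (inner ℂ (v i) (Ring.inverse (1 - w • T) x) : ℂ) •
        Ring.inverse (1 - w • D) (w • u i) := fun w hw x => by
    have h1 : Ring.inverse (1 - w • D) = Ring.inverse (1 - w • T) +
        Ring.inverse (1 - w • D) * (w • finiteRank v u) * Ring.inverse (1 - w • T) := by
      have h2 : w • finiteRank v u = (1 - w • T) - (1 - w • D) := by
        rw [hD, smul_add]; abel
      rw [h2, mul_sub, sub_mul, mul_assoc, Ring.mul_inverse_cancel _ (hTu w hw), mul_one,
        Ring.inverse_mul_cancel _ (hDu w hw), one_mul]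
      abel
    conv_lhs => rw [h1]
    rw [add_apply, mul_apply_eq_comp, mul_apply_eq_comp, smul_apply, finiteRank_apply,
      Finset.smul_sum, map_sum]
    congr 1
    refine Finset.sum_congr rfl fun i _ => ?_
    rw [smul_comm, map_smul]
  have hadjinv : ∀ (E : X →L[ℂ] X) (w : ℂ), IsUnit (1 - w • E) →
      IsUnit (1 - starRingEnd ℂ w • E.adjoint) ∧
      Ring.inverse (1 - starRingEnd ℂ w • E.adjoint) = (Ring.inverse (1 - w • E)).adjoint := by
    intro E w hE
    have h1 : 1 - starRingEnd ℂ w • E.adjoint = star (1 - w • E) := by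
      rw [star_sub, star_one, star_smul, ContinuousLinearMap.star_eq_adjoint]
      rfl
    rw [h1, ← ContinuousLinearMap.star_eq_adjoint, Ring.inverse_star]
    exact ⟨hE.star, rfl⟩
  have hadju : ∀ E : X →L[ℂ] X, (∀ w : ℂ, ‖w‖ < 1 → IsUnit (1 - w • E)) →
      ∀ w : ℂ, ‖w‖ < 1 → IsUnit (1 - w • E.adjoint) := fun E hE w hw => by
    have := (hadjinv E (starRingEnd ℂ w) (hE _ (by rwa [RCLike.norm_conj]))).1
    rwa [Complex.conj_conj] at this
  have hTadj : ∀ k : ℕ, ‖T.adjoint ^ k‖ ≤ M := fun k => by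
    rw [← ContinuousLinearMap.star_eq_adjoint, ← star_pow, norm_star]
    exact hT k
  -- The test vectors are `y` and the multiples ‖y‖ v_i; this scaling makes the resulting Abel bound
  -- a multiple of ‖y‖².
  have hbwd : ∀ w : ℂ, ‖w‖ < 1 → ∀ y, ‖Ring.inverse (1 - w • D.adjoint) y‖ ≤
      (1 + C * L) * ∑ j : Option ι, ‖Ring.inverse (1 - w • T.adjoint)
        (j.elim y fun i => (‖y‖ : ℂ) • v i)‖ := fun w hw y => by
    obtain ⟨z, rfl⟩ : ∃ z, w = starRingEnd ℂ z := ⟨starRingEnd ℂ w, by simp⟩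
    rw [RCLike.norm_conj] at hw
    rw [(hadjinv D z (hDu z hw)).2, (hadjinv T z (hTu z hw)).2]
    have h1 : (Ring.inverse (1 - z • D)).adjoint y = (Ring.inverse (1 - z • T)).adjoint y +
        ∑ i, (inner ℂ (Ring.inverse (1 - z • D) (z • u i)) y : ℂ) •
          (Ring.inverse (1 - z • T)).adjoint (v i) := by
      refine ext_inner_right ℂ fun x => ?_
      rw [ContinuousLinearMap.adjoint_inner_left, hres z hw, inner_add_right, inner_add_left,
        ContinuousLinearMap.adjoint_inner_left, inner_sum, sum_inner]
      congr 1
      refine Finset.sum_congr rfl fun i _ => ?_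
      rw [inner_smul_right, inner_smul_left, ContinuousLinearMap.adjoint_inner_left,
        inner_conj_symm, mul_comm]
    rw [h1, Fintype.sum_option, mul_add]
    refine (norm_add_le _ _).trans (add_le_add ?_ ?_)
    · exact le_mul_of_one_le_left (norm_nonneg _) (by nlinarith [mul_nonneg hC0 hL0])
    · refine (norm_sum_le _ _).trans ?_
      rw [Finset.mul_sum]
      refine Finset.sum_le_sum fun i _ => ?_
      simp only [Option.elim]
      rw [map_smul (Ring.inverse (1 - z • T)).adjoint (‖y‖ : ℂ) (v i), norm_smul, norm_smul,
        Complex.norm_real, norm_norm, ← mul_assoc]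
      refine mul_le_mul_of_nonneg_right ((norm_inner_le_norm _ _).trans ?_) (norm_nonneg _)
      refine mul_le_mul_of_nonneg_right ?_ (norm_nonneg _)
      linarith [hu z hw i]
  set C1 : ℝ := C ^ 2 * M ^ 2 with hC1
  set C2 : ℝ := (1 + C * L) ^ 2 * Fintype.card (Option ι) * M ^ 2 * (1 + ∑ i, ‖v i‖ ^ 2) with hC2
  have hC2' : 0 ≤ C2 := by
    have : 0 ≤ ∑ i, ‖v i‖ ^ 2 := Finset.sum_nonneg fun _ _ => by positivity
    positivity
  refine powerBounded_of_abel_bounds (C := C1 + C2) (by positivity) (fun r hr0 hr n x => ?_)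
    fun r hr0 hr n y => ?_
  · have h1 := abel_bound_of_norm_inverse_le (ι := Unit) hT hTu hDu x (fun _ => x)
      (fun w hw => by simpa using hfwd w hw x) hr0 hr n
    simp only [Fintype.card_unit, Nat.cast_one, mul_one, Finset.univ_unique,
      Finset.sum_const, Finset.card_singleton, one_smul] at h1
    refine h1.trans ?_
    gcongr
    linarith
  · have h1 := abel_bound_of_norm_inverse_le (ι := Option ι) hTadj (hadju T hTu) (hadju D hDu) y
      (fun j => j.elim y fun i => (‖y‖ : ℂ) • v i) (fun w hw => hbwd w hw y) hr0 hr n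
    refine h1.trans ?_
    rw [Fintype.sum_option]
    simp only [Option.elim, norm_smul, Complex.norm_real, norm_norm, mul_pow]
    rw [← Finset.mul_sum]
    calc _ = C2 * ‖y‖ ^ 2 := by rw [hC2]; ring
      _ ≤ _ := by gcongr; linarith [show 0 ≤ C1 by positivity]

end FiniteRank

/-! ### Generators, eigenvectors and bounded semigroups. -/

section Semigroup

variable {X : Type*} [NormedAddCommGroup X] [InnerProductSpace ℂ X]

/-- The function e^{-tz} g(t) is continuous with zero right derivative, hence constant. -/
theorem eq_exp_smul_of_hasDerivWithinAt {E : Type*} [NormedAddCommGroup E] [NormedSpace ℂ E]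
    {g : ℝ → E} {z : ℂ} (hg : ContinuousOn g (Set.Ici 0))
    (hd : ∀ t, 0 ≤ t → HasDerivWithinAt g (z • g t) (Set.Ici t) t) {t : ℝ} (ht : 0 ≤ t) :
    g t = Complex.exp (t * z) • g 0 := by
  have he : ∀ t : ℝ, HasDerivAt (fun t : ℝ => Complex.exp (-(t * z))) (Complex.exp (-(t * z)) * -z) t :=
    fun t => by
      have h1 : HasDerivAt (fun t : ℝ => -((t : ℂ) * z)) (-(1 * z)) t :=
        ((Complex.ofRealCLM.hasDerivAt (x := t)).mul_const z).neg
      simpa using h1.cexp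
  have h0 := constant_of_has_deriv_right_zero (a := 0) (b := t)
    (f := fun t : ℝ => Complex.exp (-(t * z)) • g t)
    (ContinuousOn.smul (Continuous.continuousOn (by fun_prop)) (hg.mono Set.Icc_subset_Ici_self))
    (fun x hx => by
      have := (he x).hasDerivWithinAt (s := Set.Ici x) |>.smul (hd x hx.1)
      refine this.congr_deriv ?_
      rw [smul_smul, ← add_smul]
      simp) t ⟨ht, le_rfl⟩
  simp only [Complex.ofReal_zero, zero_mul, neg_zero, Complex.exp_zero, one_smul] at h0
  rw [← h0, smul_smul, ← Complex.exp_add, add_neg_cancel, Complex.exp_zero, one_smul]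

variable {A : X →ₗ.[ℂ] X} {S : C0Semigroup X}

theorem C0Semigroup.tendsto_difference_quotient (hA : IsGenerator A S) (x : A.domain) {t : ℝ}
    (ht : 0 ≤ t) :
    Tendsto (fun h : ℝ => (h : ℂ)⁻¹ • (S.T (t + h) x - S.T t x)) (𝓝[>] 0) (𝓝 (S.T t (A x))) := by
  have h1 := (hA x (A x)).1 ⟨x.2, rfl⟩
  refine ((((S.T t).continuous.tendsto _).comp h1)).congr' ?_
  filter_upwards [self_mem_nhdsWithin] with h hh
  rw [Function.comp_apply, map_smul, map_sub, S.map_add t h ht (le_of_lt hh),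
    ContinuousLinearMap.comp_apply]

theorem C0Semigroup.hasDerivWithinAt (hA : IsGenerator A S) (x : A.domain) {t : ℝ} (ht : 0 ≤ t) :
    HasDerivWithinAt (fun t => S.T t x) (S.T t (A x)) (Set.Ici t) t := by
  rw [← hasDerivWithinAt_Ioi_iff_Ici, hasDerivWithinAt_iff_tendsto_slope' (by simp)]
  have hmap : Tendsto (fun s : ℝ => s - t) (𝓝[>] t) (𝓝[>] 0) := by
    refine tendsto_nhdsWithin_iff.2 ⟨?_, ?_⟩
    · have : Tendsto (fun s : ℝ => s - t) (𝓝 t) (𝓝 (t - t)) := (continuous_sub_right t).tendsto t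
      rw [sub_self] at this
      exact this.mono_left nhdsWithin_le_nhds
    · filter_upwards [self_mem_nhdsWithin] with s hs
      exact Set.mem_Ioi.2 (sub_pos.2 (Set.mem_Ioi.1 hs))
  refine ((S.tendsto_difference_quotient hA x ht).comp hmap).congr fun s => ?_
  rw [Function.comp_apply, add_sub_cancel, slope_def_module, ← Complex.ofReal_inv, Complex.coe_smul]

/-- The domain of the generator is invariant, and the generator commutes with the semigroup. -/
theorem C0Semigroup.generator_apply (hA : IsGenerator A S) (x : A.domain) {t : ℝ} (ht : 0 ≤ t) :
    ∃ hx : S.T t x ∈ A.domain, A ⟨S.T t x, hx⟩ = S.T t (A x) := by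
  refine (hA _ _).2 ((S.tendsto_difference_quotient hA x ht).congr' ?_)
  filter_upwards [self_mem_nhdsWithin] with h hh
  rw [add_comm t h, S.map_add h t (le_of_lt hh) ht, ContinuousLinearMap.comp_apply]

theorem C0Semigroup.apply_eigenvector (hA : IsGenerator A S) {z : ℂ} {x : X}
    (hx : IsEigenpair A z x) {t : ℝ} (ht : 0 ≤ t) : S.T t x = Complex.exp (t * z) • x := by
  obtain ⟨-, hxd, hxe⟩ := hx
  have := eq_exp_smul_of_hasDerivWithinAt (z := z) (S.strong_cont x) (fun t ht => by
    have := S.hasDerivWithinAt hA ⟨x, hxd⟩ ht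
    rwa [hxe, map_smul] at this) ht
  rwa [S.map_zero, ContinuousLinearMap.id_apply] at this

theorem eq_zero_of_bounded_exp_smul {E : Type*} [NormedAddCommGroup E] [NormedSpace ℂ E] {y : E}
    {z : ℂ} (hz : 0 < z.re) {M : ℝ} (h : ∀ t : ℝ, 0 ≤ t → ‖Complex.exp (t * z) • y‖ ≤ M) :
    y = 0 := by
  by_contra hy
  have hy' : 0 < ‖y‖ := norm_pos_iff.2 hy
  have h1 : Tendsto (fun t : ℝ => Real.exp (t * z.re) * ‖y‖) atTop atTop :=
    (Real.tendsto_exp_atTop.comp (tendsto_id.atTop_mul_const hz)).atTop_mul_const hy'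
  obtain ⟨t, ht, ht0⟩ := ((h1.eventually_gt_atTop M).and (eventually_ge_atTop 0)).exists
  have h2 := h t ht0
  rw [norm_smul, Complex.norm_exp] at h2
  simp only [Complex.mul_re, Complex.ofReal_re, Complex.ofReal_im, zero_mul, sub_zero] at h2
  linarith

theorem not_isEigenpair_of_uniformlyBounded (hA : IsGenerator A S) (hS : S.UniformlyBounded)
    {z : ℂ} (hz : 0 < z.re) (x : X) : ¬ IsEigenpair A z x := by
  intro hx
  obtain ⟨M, hM⟩ := hS
  refine hx.1 (eq_zero_of_bounded_exp_smul hz (M := M * ‖x‖) fun t ht => ?_)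
  rw [← S.apply_eigenvector hA hx ht]
  exact (S.T t).le_of_opNorm_le (hM t ht) x

/-- A bounded semigroup has no unstable left eigenvectors. -/
theorem inner_eq_zero_of_uniformlyBounded (hA : IsGenerator A S) (hS : S.UniformlyBounded)
    {z : ℂ} (hz : 0 < z.re) {y : X}
    (hy : ∀ x : A.domain, (inner ℂ y (A x) : ℂ) = z * inner ℂ y (x : X)) (x : A.domain) :
    (inner ℂ y (x : X) : ℂ) = 0 := by
  obtain ⟨M, hM⟩ := hS
  refine eq_zero_of_bounded_exp_smul hz (M := ‖y‖ * (M * ‖(x : X)‖)) fun t ht => ?_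
  -- The scalar orbit against `y` solves g' = z g, so it is e^{tz} g(0); with Re z > 0, boundedness
  -- forces g(0) = 0.
  have h1 := eq_exp_smul_of_hasDerivWithinAt (z := z) (g := fun t => (inner ℂ y (S.T t x) : ℂ))
    ((innerSL ℂ y).continuous.comp_continuousOn (S.strong_cont x)) (fun t ht => by
      obtain ⟨hd, he⟩ := S.generator_apply hA x ht
      have h2 := ((innerSL ℂ y).restrictScalars ℝ).hasFDerivAt.comp_hasDerivWithinAt t
        (S.hasDerivWithinAt hA x ht)
      rw [← he] at h2
      rw [smul_eq_mul, ← hy ⟨S.T t x, hd⟩]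
      exact h2) ht
  rw [S.map_zero, ContinuousLinearMap.id_apply] at h1
  rw [← h1]
  exact (norm_inner_le_norm _ _).trans
    (mul_le_mul_of_nonneg_left ((S.T t).le_of_opNorm_le (hM t ht) x) (norm_nonneg _))

end Semigroup

/-! ### The plant in spectral coordinates. -/

section Spectral

variable {X : Type*} [NormedAddCommGroup X] [InnerProductSpace ℂ X]
  {A : X →ₗ.[ℂ] X} {T : C0Semigroup X} {lam : ℕ → ℂ} {φ ψ : ℕ → X}

theorem inner_semigroup_apply (hT : IsGenerator A T) (hA : IsRieszSpectral A lam φ)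
    (hbi : ∀ n m, inner ℂ (ψ m) (φ n) = if n = m then (1 : ℂ) else 0) (n : ℕ) {t : ℝ}
    (ht : 0 ≤ t) (x : X) :
    (inner ℂ (ψ n) (T.T t x) : ℂ) = Complex.exp (t * lam n) * inner ℂ (ψ n) x := by
  refine hA.basis.induction (P := fun x => (inner ℂ (ψ n) (T.T t x) : ℂ) =
    Complex.exp (t * lam n) * inner ℂ (ψ n) x) (isClosed_eq (by fun_prop) (by fun_prop))
    (fun s a => ?_) x
  rw [map_sum]
  have h1 : ∀ k, T.T t (a k • φ k) = (a k * Complex.exp (t * lam k)) • φ k := fun k => by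
    rw [map_smul, T.apply_eigenvector hT (hA.eigenvector k) ht, smul_smul]
  simp only [h1]
  rw [inner_sum_of_biorthogonal hbi, inner_sum_of_biorthogonal hbi]
  split_ifs
  · ring
  · simp

/-- Both sides are the right derivative at 0 of the n-th coordinate of T(t)x, computed from the
generator and from the scalar exponential. -/
theorem inner_generator_apply (hT : IsGenerator A T) (hA : IsRieszSpectral A lam φ)
    (hbi : ∀ n m, inner ℂ (ψ m) (φ n) = if n = m then (1 : ℂ) else 0) (n : ℕ) (x : A.domain) :
    (inner ℂ (ψ n) (A x) : ℂ) = lam n * inner ℂ (ψ n) (x : X) := by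
  have h1 := ((innerSL ℂ (ψ n)).restrictScalars ℝ).hasFDerivAt.comp_hasDerivWithinAt 0
    (T.hasDerivWithinAt hT x le_rfl)
  rw [T.map_zero] at h1
  have h2 : HasDerivWithinAt (fun t : ℝ => Complex.exp (t * lam n) * inner ℂ (ψ n) (x : X))
      (lam n * inner ℂ (ψ n) (x : X)) (Set.Ici 0) 0 := by
    have h3 : HasDerivAt (fun t : ℝ => (t : ℂ) * lam n) (1 * lam n) 0 :=
      (Complex.ofRealCLM.hasDerivAt (x := 0)).mul_const _
    simpa using (h3.cexp.mul_const (inner ℂ (ψ n) (x : X))).hasDerivWithinAt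
  have h3 : HasDerivWithinAt (fun t : ℝ => Complex.exp (t * lam n) * inner ℂ (ψ n) (x : X))
      (inner ℂ (ψ n) (A x)) (Set.Ici 0) 0 := by
    refine HasDerivWithinAt.congr h1 (fun t ht => ?_) ?_
    · exact (inner_semigroup_apply hT hA hbi n ht (x : X)).symm
    · exact (inner_semigroup_apply hT hA hbi n le_rfl (x : X)).symm
  exact (uniqueDiffWithinAt_Ici (0 : ℝ)).eq_deriv _ h3 h2

variable [CompleteSpace X]

/-- The resolvent equation `(s - A) x = b` is solved by the spectral expansion. -/
theorem exists_resolvent_expansion (hA : IsRieszSpectral A lam φ)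
    (hbi : ∀ n m, inner ℂ (ψ m) (φ n) = if n = m then (1 : ℂ) else 0) (b : X) {s : ℂ}
    (hs : ∀ n, s ≠ lam n) (hsum : Summable fun n => ‖(inner ℂ (ψ n) b : ℂ) / (s - lam n)‖ ^ 2) :
    ∃ hx : (∑' n, ((inner ℂ (ψ n) b : ℂ) / (s - lam n)) • φ n) ∈ A.domain,
      A ⟨_, hx⟩ = s • (∑' n, ((inner ℂ (ψ n) b : ℂ) / (s - lam n)) • φ n) - b := by
  obtain ⟨Mb, hMb, hS⟩ := hA.basis.exists_synthesis_bound
  have h1 := (hS _ hsum).1.hasSum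
  set x := ∑' n, ((inner ℂ (ψ n) b : ℂ) / (s - lam n)) • φ n with hx
  have h2 := (h1.const_smul s).sub (hasSum_inner_smul hA.basis hbi b)
  have h3 := h1.prodMk h2
  -- The partial sums of the pair lie in the graph termwise, and the graph is closed.
  have hmem : (x, s • x - b) ∈ A.graph := by
    refine hA.closed.mem_of_tendsto h3 (Eventually.of_forall fun t => ?_)
    refine Submodule.sum_mem _ fun n _ => ?_
    obtain ⟨-, hd, he⟩ := hA.eigenvector n
    have h4 : (φ n, lam n • φ n) ∈ A.graph := by
      have := A.mem_graph ⟨φ n, hd⟩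
      rwa [he] at this
    have h5 := A.graph.smul_mem ((inner ℂ (ψ n) b : ℂ) / (s - lam n)) h4
    convert h5 using 1
    rw [Prod.smul_mk, smul_smul, smul_smul, ← sub_smul]
    congr 2
    have := sub_ne_zero.2 (hs n)
    field_simp
    ring
  obtain ⟨y, hy1, hy2⟩ := (LinearPMap.mem_graph_iff A).1 hmem
  obtain ⟨y, hyd⟩ := y
  simp only at hy1 hy2
  subst hy1
  exact ⟨hyd, hy2⟩

/-- Integrating e^{sλ_n} over [0, t] produces the quotients ⟨b, ψ_n⟩/λ_n that (A5) controls. -/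
theorem inner_inputMap (hT : IsGenerator A T) (hA : IsRieszSpectral A lam φ)
    (hbi : ∀ n m, inner ℂ (ψ m) (φ n) = if n = m then (1 : ℂ) else 0) {B : ℂ →L[ℂ] X} {b : X}
    (hB : ∀ u : ℂ, B u = u • b) (n : ℕ) (hn : lam n ≠ 0) {t : ℝ} (ht : 0 ≤ t) :
    (inner ℂ (ψ n) (inputMap T B t 1) : ℂ) =
      (Complex.exp (t * lam n) - 1) * (inner ℂ (ψ n) b / lam n) := by
  have hBs : ∀ s : ℝ, (T.T s).comp B = ContinuousLinearMap.toSpanSingleton ℂ (T.T s b) := fun s => by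
    ext
    simp [hB]
  have hc : ContinuousOn (fun s : ℝ => (T.T s).comp B) (Set.uIcc 0 t) := by
    simp only [hBs]
    rw [Set.uIcc_of_le ht]
    exact (ContinuousLinearMap.toSpanSingletonCLE (𝕜 := ℂ) (E := X)).continuous.comp_continuousOn
      ((T.strong_cont b).mono Set.Icc_subset_Ici_self)
  have hi : IntervalIntegrable (fun s : ℝ => (T.T s).comp B) MeasureTheory.volume 0 t :=
    hc.intervalIntegrable
  have h1 := ((innerSL ℂ (ψ n)).comp
    (ContinuousLinearMap.apply ℂ X (1 : ℂ))).intervalIntegral_comp_comm hi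
  have h2 : (inner ℂ (ψ n) (inputMap T B t 1) : ℂ) =
      ∫ s in (0 : ℝ)..t, Complex.exp (lam n * s) * inner ℂ (ψ n) b := by
    refine Eq.trans h1.symm (intervalIntegral.integral_congr fun s hs => ?_)
    rw [Set.uIcc_of_le ht] at hs
    simp only [ContinuousLinearMap.comp_apply, ContinuousLinearMap.apply_apply,
      innerSL_apply_apply, hB, one_smul]
    rw [inner_semigroup_apply hT hA hbi n hs.1, mul_comm (s : ℂ)]
  rw [h2, intervalIntegral.integral_mul_const, integral_exp_mul_complex hn]
  rw [Complex.ofReal_zero, mul_zero, Complex.exp_zero, mul_comm (lam n)]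
  ring

end Spectral

/-! ### The sampled characteristic function and its limit as τ → 0. -/

section Scalar

/-- This is |e^w - 1| ≤ ∫₀¹ |w| e^{t Re w} dt, multiplied through by -Re w so that Re w = 0 is
allowed. -/
theorem norm_exp_sub_one_mul_neg_re_le {w : ℂ} (hw : w.re ≤ 0) :
    ‖Complex.exp w - 1‖ * -w.re ≤ ‖w‖ * (1 - Real.exp w.re) := by
  rcases hw.eq_or_lt with h0 | h0
  · simp [h0]
  have hd : ∀ t : ℝ, HasDerivAt (fun t : ℝ => Complex.exp (t * w) - 1) (Complex.exp (t * w) * w) t :=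
    fun t => by
      have h1 : HasDerivAt (fun t : ℝ => (t : ℂ) * w) (1 * w) t :=
        (Complex.ofRealCLM.hasDerivAt (x := t)).mul_const w
      simpa using h1.cexp.sub_const 1
  have hB : ∀ t : ℝ, HasDerivAt (fun t : ℝ => ‖w‖ * ((Real.exp (t * w.re) - 1) / w.re))
      (‖w‖ * Real.exp (t * w.re)) t := fun t => by
    have h1 : HasDerivAt (fun t : ℝ => t * w.re) (1 * w.re) t := (hasDerivAt_id t).mul_const _
    have h2 := ((h1.exp.sub_const 1).div_const w.re).const_mul ‖w‖
    refine h2.congr_deriv ?_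
    rw [one_mul, mul_div_cancel_right₀ _ h0.ne]
  have h := image_norm_le_of_norm_deriv_right_le_deriv_boundary (a := 0) (b := 1)
    (fun t _ => (hd t).continuousAt.continuousWithinAt) (fun t _ => (hd t).hasDerivWithinAt)
    (by simp) hB (fun t _ => by
      rw [norm_mul, Complex.norm_exp, mul_comm]
      simp) (Set.right_mem_Icc.2 zero_le_one)
  simp only [Complex.ofReal_one, one_mul] at h
  have h3 := mul_le_mul_of_nonneg_right h (neg_nonneg.2 hw)
  refine h3.trans_eq ?_
  field_simp [h0.ne]
  ring

/-- Sampled modes with negative real part are controlled by the inclination of the mode, uniformly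
in the sampling period and up to the boundary of the unit disc. -/
theorem norm_sampled_mode_le {z w : ℂ} {τ : ℝ} (hz : z.re < 0) (hτ : 0 < τ) (hw : ‖w‖ ≤ 1) :
    ‖w * (Complex.exp (τ * z) - 1) / (1 - w * Complex.exp (τ * z))‖ ≤ ‖z‖ / -z.re := by
  have hre : ((τ : ℂ) * z).re = τ * z.re := by simp
  have h1 := norm_exp_sub_one_mul_neg_re_le (w := τ * z)
    (by rw [hre]; exact (mul_neg_of_pos_of_neg hτ hz).le)
  rw [hre, norm_mul, Complex.norm_real, Real.norm_of_nonneg hτ.le] at h1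
  have h2 : ‖Complex.exp (τ * z) - 1‖ * -z.re ≤ ‖z‖ * (1 - Real.exp (τ * z.re)) := by
    refine le_of_mul_le_mul_left ?_ hτ
    linarith
  have hlt : Real.exp (τ * z.re) < 1 := Real.exp_lt_one_iff.2 (mul_neg_of_pos_of_neg hτ hz)
  have h3 : 1 - Real.exp (τ * z.re) ≤ ‖1 - w * Complex.exp (τ * z)‖ := by
    have h4 := norm_sub_norm_le (1 : ℂ) (w * Complex.exp (τ * z))
    rw [norm_one, norm_mul, Complex.norm_exp, hre] at h4
    have h5 : ‖w‖ * Real.exp (τ * z.re) ≤ 1 * Real.exp (τ * z.re) := by gcongr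
    linarith
  rw [norm_div, norm_mul, div_le_div_iff₀ (by linarith) (by linarith)]
  calc ‖w‖ * ‖Complex.exp (τ * z) - 1‖ * -z.re
      ≤ 1 * (‖Complex.exp (τ * z) - 1‖ * -z.re) := by
        rw [mul_assoc]
        gcongr
        exact mul_nonneg (norm_nonneg _) (by linarith)
    _ ≤ ‖z‖ * (1 - Real.exp (τ * z.re)) := by rw [one_mul]; exact h2
    _ ≤ _ := by gcongr

theorem one_sub_mul_exp_ne_zero {z w : ℂ} {τ : ℝ} (hz : z.re < 0) (hτ : 0 < τ) (hw : ‖w‖ ≤ 1) :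
    1 - w * Complex.exp (τ * z) ≠ 0 := by
  intro h
  have h1 : ‖w * Complex.exp (τ * z)‖ = 1 := by rw [← sub_eq_zero.1 h, norm_one]
  rw [norm_mul, Complex.norm_exp] at h1
  have hre : ((τ : ℂ) * z).re = τ * z.re := by simp
  rw [hre] at h1
  have hlt : Real.exp (τ * z.re) < 1 := Real.exp_lt_one_iff.2 (mul_neg_of_pos_of_neg hτ hz)
  have := mul_le_mul_of_nonneg_right hw (Real.exp_pos (τ * z.re)).le
  linarith

theorem tendsto_exp_sub_one_div {α : Type*} {l : Filter α} {τ : α → ℝ} {s : α → ℂ} {s₀ : ℂ}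
    (hτ : Tendsto τ l (𝓝 0)) (hτ0 : ∀ a, τ a ≠ 0) (hs : Tendsto s l (𝓝 s₀)) :
    Tendsto (fun a => (Complex.exp (τ a * s a) - 1) / τ a) l (𝓝 s₀) := by
  have hcont : ContinuousAt (dslope Complex.exp 0) 0 :=
    continuousAt_dslope_same.2 Complex.differentiableAt_exp
  have hτc : Tendsto (fun a => (τ a : ℂ) * s a) l (𝓝 0) := by
    have := ((Complex.continuous_ofReal.tendsto 0).comp hτ).mul hs
    simpa using this
  have h1 := hs.mul (hcont.tendsto.comp hτc)
  rw [dslope_same, Complex.deriv_exp, Complex.exp_zero, mul_one] at h1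
  refine h1.congr fun a => ?_
  have h2 := sub_smul_dslope Complex.exp 0 ((τ a : ℂ) * s a)
  rw [sub_zero, Complex.exp_zero, smul_eq_mul] at h2
  rw [← h2, Function.comp_apply, mul_assoc, mul_div_cancel_left₀]
  exact_mod_cast hτ0 a

/-- In this half-strip e^w - 1 vanishes only at 0, and simply, so the difference quotient is bounded
below on the compact rectangle Re w ≤ 1. Beyond it, |e^w - 1| ≥ e^{Re w} - 1 ≥ 1. -/
theorem exists_le_norm_exp_sub_one :
    ∃ c : ℝ, 0 < c ∧ ∀ w : ℂ, 0 ≤ w.re → |w.im| ≤ Real.pi →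
      c * min 1 ‖w‖ ≤ ‖Complex.exp w - 1‖ := by
  set Q : Set ℂ := Set.Icc 0 1 ×ℂ Set.Icc (-Real.pi) Real.pi with hQ
  have hQc : IsCompact Q := isCompact_Icc.reProdIm isCompact_Icc
  have hcont : Continuous (dslope Complex.exp 0) := by
    rw [continuous_iff_continuousAt]
    intro w
    exact (Complex.differentiableOn_dslope (s := Set.univ) univ_mem).2
      Complex.differentiable_exp.differentiableOn |>.continuousOn.continuousAt univ_mem
  have hne : ∀ w ∈ Q, dslope Complex.exp 0 w ≠ 0 := by
    intro w hw h0
    have h2 := sub_smul_dslope Complex.exp 0 w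
    rw [h0, smul_zero, Complex.exp_zero] at h2
    obtain ⟨n, hn⟩ := Complex.exp_eq_one_iff.1 (sub_eq_zero.1 h2.symm)
    have him : w.im = n * (2 * Real.pi) := by rw [hn]; simp
    have hpi := Real.pi_pos
    have hn0 : n = 0 := by
      have h3 := hw.2
      simp only [Set.mem_preimage, Set.mem_Icc] at h3
      rw [him] at h3
      have h4 : (n : ℝ) < 1 := by nlinarith [h3.2]
      have h5 : (-1 : ℝ) < n := by nlinarith [h3.1]
      have h6 : n < 1 := by exact_mod_cast h4
      have h7 : -1 < n := by exact_mod_cast h5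
      omega
    rw [hn, hn0] at h0
    simp at h0
  obtain ⟨w₀, hw₀, hmin⟩ := hQc.exists_isMinOn ⟨0, by simp [hQ, Complex.mem_reProdIm, Real.pi_pos.le]⟩
    hcont.norm.continuousOn
  have hpos : 0 < ‖dslope Complex.exp 0 w₀‖ := norm_pos_iff.2 (hne w₀ hw₀)
  refine ⟨min 1 ‖dslope Complex.exp 0 w₀‖, lt_min one_pos hpos, fun w hre him => ?_⟩
  rcases le_total w.re 1 with h1 | h1
  · have hwQ : w ∈ Q := ⟨⟨hre, h1⟩, abs_le.1 him⟩
    have h2 := sub_smul_dslope Complex.exp 0 w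
    rw [sub_zero, Complex.exp_zero, smul_eq_mul] at h2
    rw [← h2, norm_mul, mul_comm ‖w‖]
    exact mul_le_mul ((min_le_right _ _).trans (hmin hwQ)) (min_le_right _ _)
      (le_min zero_le_one (norm_nonneg _)) (norm_nonneg _)
  · have h2 := norm_sub_norm_le (Complex.exp w) 1
    rw [norm_one, Complex.norm_exp] at h2
    have h3 : 2 ≤ Real.exp w.re := by linarith [Real.add_one_le_exp w.re]
    calc _ ≤ (1 : ℝ) * 1 := mul_le_mul (min_le_left _ _) (min_le_left _ _)
          (le_min zero_le_one (norm_nonneg _)) zero_le_one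
      _ ≤ _ := by linarith

/-- Substituting w = e^{-τs} exhibits the sampled mode as z/(s - z) with z and s replaced by the
quotients (e^{τz} - 1)/τ and (e^{τs} - 1)/τ. -/
theorem sampled_mode_eq {τ : ℝ} (hτ : τ ≠ 0) (z s : ℂ) :
    Complex.exp (-(τ * s)) * (Complex.exp (τ * z) - 1) /
      (1 - Complex.exp (-(τ * s)) * Complex.exp (τ * z)) =
    ((Complex.exp (τ * z) - 1) / τ) /
      ((Complex.exp (τ * s) - 1) / τ - (Complex.exp (τ * z) - 1) / τ) := by
  have hτ' : (τ : ℂ) ≠ 0 := by exact_mod_cast hτ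
  rw [← sub_div, div_div_div_cancel_right₀ hτ', Complex.exp_neg, sub_sub_sub_cancel_right]
  have he := Complex.exp_ne_zero (τ * s)
  rw [← mul_div_mul_left _ (1 - (Complex.exp (τ * s))⁻¹ * Complex.exp (τ * z)) he]
  congr 1
  · field_simp
  · field_simp

theorem tendsto_sampled_mode {α : Type*} {l : Filter α} {τ : α → ℝ} {s : α → ℂ} {s₀ z : ℂ}
    (hτ : Tendsto τ l (𝓝 0)) (hτ0 : ∀ a, τ a ≠ 0) (hs : Tendsto s l (𝓝 s₀)) (hz : s₀ ≠ z) :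
    Tendsto (fun a => Complex.exp (-(τ a * s a)) * (Complex.exp (τ a * z) - 1) /
      (1 - Complex.exp (-(τ a * s a)) * Complex.exp (τ a * z))) l (𝓝 (z / (s₀ - z))) := by
  simp only [fun a => sampled_mode_eq (hτ0 a) z (s a)]
  have h1 := tendsto_exp_sub_one_div hτ hτ0 (tendsto_const_nhds (x := z))
  exact h1.div ((tendsto_exp_sub_one_div hτ hτ0 hs).sub h1) (sub_ne_zero.2 hz)

/-- The quotient (e^{τs} - 1)/τ is at least a constant times min(1/τ, |s|), so the denominator of
`sampled_mode_eq` diverges while its numerator tends to z. -/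
theorem tendsto_sampled_mode_zero {α : Type*} {l : Filter α} {τ : α → ℝ} {s : α → ℂ} (z : ℂ)
    (hτ : Tendsto τ l (𝓝 0)) (hτ0 : ∀ a, 0 < τ a) (hs : Tendsto (fun a => ‖s a‖) l atTop)
    (hre : ∀ a, 0 ≤ (s a).re) (him : ∀ a, |τ a * (s a).im| ≤ Real.pi) :
    Tendsto (fun a => Complex.exp (-(τ a * s a)) * (Complex.exp (τ a * z) - 1) /
      (1 - Complex.exp (-(τ a * s a)) * Complex.exp (τ a * z))) l (𝓝 0) := by
  simp only [fun a => sampled_mode_eq (hτ0 a).ne' z (s a)]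
  have h1 := tendsto_exp_sub_one_div hτ (fun a => (hτ0 a).ne') (tendsto_const_nhds (x := z))
  obtain ⟨c, hc, hlow⟩ := exists_le_norm_exp_sub_one
  have hinv : Tendsto (fun a => (τ a)⁻¹) l atTop :=
    tendsto_inv_nhdsGT_zero.comp (tendsto_nhdsWithin_iff.2 ⟨hτ, Eventually.of_forall hτ0⟩)
  have hmin : Tendsto (fun a => c * min (τ a)⁻¹ ‖s a‖) l atTop := by
    refine Tendsto.const_mul_atTop hc (tendsto_atTop.2 fun R => ?_)
    filter_upwards [hinv.eventually_ge_atTop R, hs.eventually_ge_atTop R] with a ha hb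
    exact le_min ha hb
  have hbig : Tendsto (fun a => ‖(Complex.exp (τ a * s a) - 1) / τ a‖) l atTop := by
    refine tendsto_atTop_mono (fun a => ?_) hmin
    have h2 := hlow (τ a * s a) (by simpa using mul_nonneg (hτ0 a).le (hre a))
      (by simpa using him a)
    rw [norm_mul, Complex.norm_real, Real.norm_of_nonneg (hτ0 a).le] at h2
    rw [norm_div, Complex.norm_real, Real.norm_of_nonneg (hτ0 a).le, le_div_iff₀ (hτ0 a)]
    refine le_trans (le_of_eq ?_) h2
    rw [mul_assoc, min_mul_of_nonneg _ _ (hτ0 a).le, inv_mul_cancel₀ (hτ0 a).ne', mul_comm ‖s a‖]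
  have hden : Tendsto (fun a => ‖(Complex.exp (τ a * s a) - 1) / τ a -
      (Complex.exp (τ a * z) - 1) / τ a‖) l atTop := by
    refine tendsto_atTop_mono (fun a => norm_sub_norm_le _ _) ?_
    simpa only [sub_eq_add_neg] using hbig.atTop_add h1.norm.neg
  have h3 := h1.mul (tendsto_inv₀_cobounded.comp (tendsto_norm_atTop_iff_cobounded.1 hden))
  simpa only [mul_zero, div_eq_mul_inv, Function.comp_def] using h3

/-- Nonvanishing of the sampled characteristic function for small sampling periods. -/
theorem exists_forall_tsum_sampled_mode_ne_one {lam c : ℕ → ℂ} {K : ℝ}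
    (hinj : Function.Injective lam) (him : ∀ n, (lam n).re ≠ 0)
    (hfin : {n | 0 < (lam n).re}.Finite)
    (hK : ∀ n, (lam n).re < 0 → ‖lam n‖ / -(lam n).re ≤ K * (1 + ‖lam n‖))
    (hc : Summable fun n => ‖c n‖) (hcl : Summable fun n => ‖c n * lam n‖)
    (h0 : ∑' n, c n ≠ -1)
    (hs : ∀ s : ℂ, 0 ≤ s.re → s ≠ 0 → (∀ n, s ≠ lam n) → ∑' n, c n * (lam n / (s - lam n)) ≠ 1)
    (hunst : ∀ n, 0 < (lam n).re → c n ≠ 0) :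
    ∃ τs : ℝ, 0 < τs ∧ ∀ τ : ℝ, 0 < τ → τ < τs → ∀ w : ℂ, ‖w‖ ≤ 1 → w ≠ 0 →
      (∀ n, 1 - w * Complex.exp (τ * lam n) ≠ 0) →
      ∑' n, c n * (w * (Complex.exp (τ * lam n) - 1) / (1 - w * Complex.exp (τ * lam n))) ≠ 1 := by
  by_contra! hcon
  choose τ hτ0 hτ1 w hw1 hw0 hwn hsum using fun k : ℕ =>
    hcon (1 / ((k : ℝ) + 1)) (by positivity)
  -- Along an ultrafilter the sequence s_k below either converges or has norm tending to infinity,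
  -- with no passage to subsequences.
  set U : Ultrafilter ℕ := Ultrafilter.of atTop with hU
  have hUle : (U : Filter ℕ) ≤ atTop := Ultrafilter.of_le _
  have hτU : Tendsto τ U (𝓝 0) := by
    refine Tendsto.mono_left ?_ hUle
    exact squeeze_zero (fun k => (hτ0 k).le) (fun k => (hτ1 k).le)
      tendsto_one_div_add_atTop_nhds_zero_nat
  -- The principal logarithm gives |τ Im s| ≤ π, as `tendsto_sampled_mode_zero` requires; |w| ≤ 1
  -- gives Re s ≥ 0.
  set s : ℕ → ℂ := fun k => -(Complex.log (w k) / τ k) with hsdef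
  have hτc : ∀ k, (τ k : ℂ) ≠ 0 := fun k => by exact_mod_cast (hτ0 k).ne'
  have hτs : ∀ k, (τ k : ℂ) * s k = -Complex.log (w k) := fun k => by
    rw [hsdef]
    field_simp [hτc k]
  have hws : ∀ k, w k = Complex.exp (-(τ k * s k)) := fun k => by
    rw [hτs, neg_neg, Complex.exp_log (hw0 k)]
  have hre : ∀ k, 0 ≤ (s k).re := fun k => by
    have h1 : τ k * (s k).re = -Real.log ‖w k‖ := by
      have := congrArg Complex.re (hτs k)
      simpa [Complex.log_re] using this
    have h2 : Real.log ‖w k‖ ≤ 0 := Real.log_nonpos (norm_nonneg _) (hw1 k)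
    by_contra! hneg
    have := mul_neg_of_pos_of_neg (hτ0 k) hneg
    linarith
  have himk : ∀ k, |τ k * (s k).im| ≤ Real.pi := fun k => by
    have h1 : τ k * (s k).im = -(w k).arg := by
      have := congrArg Complex.im (hτs k)
      simpa [Complex.log_im] using this
    rw [h1, abs_neg]
    exact Complex.abs_arg_le_pi _
  set H : ℕ → ℕ → ℂ := fun k n =>
    w k * (Complex.exp (τ k * lam n) - 1) / (1 - w k * Complex.exp (τ k * lam n)) with hH
  -- Stable modes have a summable bound independent of k. For the finitely many unstable ones the
  -- indicator replaces it by ‖g n‖ + 1, valid eventually. The factor `d` serves to cancel a pole.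
  have hdom : ∀ (d : ℕ → ℂ) (g : ℕ → ℂ), (∀ᶠ k in (U : Filter ℕ), ‖d k‖ ≤ 1) →
      (∀ n, Tendsto (fun k => d k * (c n * H k n)) U (𝓝 (g n))) →
      Tendsto (fun k => ∑' n, d k * (c n * H k n)) U (𝓝 (∑' n, g n)) := by
    intro d g hd hg
    refine tendsto_tsum_of_dominated_convergence
      (bound := fun n => K * (‖c n‖ + ‖c n * lam n‖) +
        Set.indicator {n | 0 < (lam n).re} (fun n => ‖g n‖ + 1 - K * (‖c n‖ + ‖c n * lam n‖)) n)
      (((hc.add hcl).mul_left K).add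
        (summable_of_hasFiniteSupport (hfin.subset (Set.support_indicator_subset)))) hg ?_
    have hun : ∀ᶠ k in (U : Filter ℕ), ∀ n ∈ {n | 0 < (lam n).re},
        ‖d k * (c n * H k n)‖ ≤ ‖g n‖ + 1 := by
      rw [eventually_all_finite hfin]
      intro n _
      exact (hg n).norm.eventually_le_const (by linarith)
    filter_upwards [hd, hun] with k hk1 hk2 n
    by_cases hn : 0 < (lam n).re
    · rw [Set.indicator_of_mem (s := {n | 0 < (lam n).re}) hn]
      linarith [hk2 n hn]
    · rw [Set.indicator_of_notMem (s := {n | 0 < (lam n).re}) hn, add_zero]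
      have hneg : (lam n).re < 0 := lt_of_le_of_ne (not_lt.1 hn) (him n)
      have hb := (norm_sampled_mode_le hneg (hτ0 k) (hw1 k)).trans (hK n hneg)
      calc ‖d k * (c n * H k n)‖ = ‖d k‖ * (‖c n‖ * ‖H k n‖) := by rw [norm_mul, norm_mul]
        _ ≤ 1 * (‖c n‖ * (K * (1 + ‖lam n‖))) := by gcongr
        _ = _ := by rw [norm_mul]; ring
  have hone : ∀ k, ∑' n, 1 * (c n * H k n) = 1 := fun k => by simpa using hsum k
  by_cases hbdd : ∃ R : ℝ, ∀ᶠ k in (U : Filter ℕ), ‖s k‖ ≤ R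
  · obtain ⟨R, hR⟩ := hbdd
    obtain ⟨s₀, -, hs₀⟩ := (isCompact_closedBall (0 : ℂ) R).ultrafilter_le_nhds (U.map s)
      (by
        refine Filter.le_principal_iff.2 ?_
        change s ⁻¹' _ ∈ (U : Filter ℕ)
        filter_upwards [hR] with k hk
        simpa using hk)
    have hs₀' : Tendsto s U (𝓝 s₀) := hs₀
    have hs₀re : 0 ≤ s₀.re :=
      ge_of_tendsto ((Complex.continuous_re.tendsto _).comp hs₀') (Eventually.of_forall hre)
    have hlim : ∀ n, s₀ ≠ lam n → Tendsto (fun k => H k n) U (𝓝 (lam n / (s₀ - lam n))) :=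
      fun n hn => by
        have := tendsto_sampled_mode hτU (fun k => (hτ0 k).ne') hs₀' hn
        simpa only [← hws] using this
    by_cases hex : ∃ m, s₀ = lam m
    · obtain ⟨m, hm⟩ := hex
      have hmpos : 0 < (lam m).re := lt_of_le_of_ne (hm ▸ hs₀re) (him m).symm
      -- At a pole s₀ = λ_m the sum is multiplied by the vanishing denominator of mode m: only the
      -- residue c_m λ_m ≠ 0 survives, whereas the sum being 1 forces the limit 0.
      set d : ℕ → ℂ := fun k => (Complex.exp (τ k * s k) - 1) / τ k -
        (Complex.exp (τ k * lam m) - 1) / τ k with hd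
      have hd0 : Tendsto d U (𝓝 0) := by
        have := (tendsto_exp_sub_one_div hτU (fun k => (hτ0 k).ne') hs₀').sub
          (tendsto_exp_sub_one_div hτU (fun k => (hτ0 k).ne') (tendsto_const_nhds (x := lam m)))
        rwa [hm, sub_self] at this
      have hdH : ∀ k, d k * H k m = (Complex.exp (τ k * lam m) - 1) / τ k := fun k => by
        have hne : d k ≠ 0 := by
          intro h
          rw [hd] at h
          simp only [← sub_div, sub_sub_sub_cancel_right, div_eq_zero_iff, hτc k, or_false] at h
          refine hwn k m ?_
          rw [hws, ← sub_eq_zero.1 h, Complex.exp_neg, inv_mul_cancel₀ (Complex.exp_ne_zero _),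
            sub_self]
        have h1 : H k m = ((Complex.exp (τ k * lam m) - 1) / τ k) / d k := by
          rw [hH]
          simp only
          rw [hws k]
          exact sampled_mode_eq (hτ0 k).ne' (lam m) (s k)
        rw [h1, mul_div_cancel₀ _ hne]
      have h1 := hdom d (fun n => if n = m then c m * lam m else 0)
        ((hd0.norm.eventually_le_const (by simp)))
        (fun n => by
          by_cases hn : n = m
          · subst hn
            simp only [if_true]
            have h2 := (tendsto_exp_sub_one_div hτU (fun k => (hτ0 k).ne')
              (tendsto_const_nhds (x := lam n))).const_mul (c n)
            refine h2.congr fun k => ?_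
            rw [← hdH]
            ring
          · rw [if_neg hn]
            have h2 := hd0.mul ((hlim n (fun h => hn (hinj (h.symm.trans hm)))).const_mul (c n))
            rwa [zero_mul] at h2)
      rw [tsum_ite_eq] at h1
      have h2 : (fun k => ∑' n, d k * (c n * H k n)) = d := by
        ext k
        rw [tsum_mul_left]
        have := hsum k
        rw [this, mul_one]
      rw [h2] at h1
      have h3 := tendsto_nhds_unique h1 hd0
      exact mul_ne_zero (hunst m hmpos) (fun h => him m (by rw [h]; rfl)) h3
    · push Not at hex
      have h1 := hdom (fun _ => 1) (fun n => c n * (lam n / (s₀ - lam n))) (by simp)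
        (fun n => by simpa using (hlim n (hex n)).const_mul (c n))
      simp only [hone] at h1
      have h2 := tendsto_nhds_unique h1 tendsto_const_nhds
      by_cases hz : s₀ = 0
      · subst hz
        have h3 : ∀ n, c n * (lam n / (0 - lam n)) = -c n := fun n => by
          rw [zero_sub, div_neg, div_self (hex n).symm]
          ring
        simp only [h3, tsum_neg] at h2
        exact h0 (by rw [← h2, neg_neg])
      · exact hs s₀ hs₀re hz hex h2
  · push Not at hbdd
    have hinf : Tendsto (fun k => ‖s k‖) U atTop := by
      refine tendsto_atTop.2 fun R => ?_
      filter_upwards [hbdd R] with k hk using hk.le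
    have h1 := hdom (fun _ => 1) (fun _ => 0) (by simp) (fun n => by
      have := tendsto_sampled_mode_zero (lam n) hτU hτ0 hinf hre himk
      simp only [← hws] at this
      simpa using this.const_mul (c n))
    simp only [hone, tsum_zero] at h1
    exact one_ne_zero (tendsto_nhds_unique tendsto_const_nhds h1)

end Scalar

/-! ### Eigenvalue geometry and coefficient estimates. -/

section Coefficients

/-- A stable eigenvalue has Re λ ≤ -a, where the ratio is at most |λ|/a; or lies outside the sector,
where it is at most 1/sin e; or is one of finitely many exceptions. `K` adds the three constants. -/
theorem exists_inclination_bound {lam : ℕ → ℂ} (hinj : Function.Injective lam) {a d : ℝ}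
    (ha : 0 < a) (hd : 0 < d)
    (hfin : (Set.range lam ∩ (halfPlane (-a) ∩ sector (Real.pi / 2 + d))).Finite) :
    {n | 0 < (lam n).re}.Finite ∧ ∃ K : ℝ, 0 ≤ K ∧
      ∀ n, (lam n).re < 0 → ‖lam n‖ / -(lam n).re ≤ K * (1 + ‖lam n‖) := by
  set I : Set ℕ := lam ⁻¹' (Set.range lam ∩ (halfPlane (-a) ∩ sector (Real.pi / 2 + d))) with hI
  have hIfin : I.Finite := hfin.preimage hinj.injOn
  refine ⟨hIfin.subset fun n hn => ⟨⟨n, rfl⟩, ?_, ?_, ?_⟩, ?_⟩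
  · have : 0 < (lam n).re := hn
    change -a < (lam n).re
    linarith
  · rintro h
    have : 0 < (lam n).re := hn
    rw [h] at this
    simp at this
  · have : |(lam n).arg| < Real.pi / 2 := Complex.abs_arg_lt_pi_div_two_iff.2 (Or.inl hn)
    linarith
  · have hpi := Real.pi_pos
    -- The cap at π/2 keeps π/2 + e ≤ π, where cosine is decreasing, and sin e > 0.
    set e := min d (Real.pi / 2) with he
    have he0 : 0 < e := lt_min hd (by linarith)
    have hsin : 0 < Real.sin e := Real.sin_pos_of_pos_of_lt_pi he0
      ((min_le_right _ _).trans_lt (by linarith))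
    have hsum0 : ∀ n ∈ hIfin.toFinset, 0 ≤ |‖lam n‖ / -(lam n).re| := fun _ _ => abs_nonneg _
    have hS0 := Finset.sum_nonneg hsum0
    refine ⟨a⁻¹ + (Real.sin e)⁻¹ + ∑ n ∈ hIfin.toFinset, |‖lam n‖ / -(lam n).re|, by positivity,
      fun n hn => ?_⟩
    set S := ∑ n ∈ hIfin.toFinset, |‖lam n‖ / -(lam n).re| with hS
    have hl := norm_nonneg (lam n)
    have hneg : 0 < -(lam n).re := by linarith
    have ha' : 0 < a⁻¹ := inv_pos.2 ha
    have hs' : 0 < (Real.sin e)⁻¹ := inv_pos.2 hsin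
    by_cases hnI : n ∈ I
    · have h1 : ‖lam n‖ / -(lam n).re ≤ S := (le_abs_self _).trans
        (Finset.single_le_sum hsum0 (hIfin.mem_toFinset.2 hnI))
      nlinarith [mul_nonneg hS0 hl, mul_nonneg ha'.le hl, mul_nonneg hs'.le hl]
    · by_cases hna : -a < (lam n).re
      · have hne : lam n ≠ 0 := by
          intro h
          rw [h] at hn
          simp at hn
        have harg : Real.pi / 2 + d ≤ |(lam n).arg| := by
          by_contra! hlt
          exact hnI ⟨⟨n, rfl⟩, hna, hne, hlt⟩
        have h1 : Real.cos (lam n).arg ≤ -Real.sin e := by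
          rw [← Real.cos_abs, ← Real.cos_add_pi_div_two]
          refine Real.cos_le_cos_of_nonneg_of_le_pi (by linarith) (Complex.abs_arg_le_pi _) ?_
          linarith [min_le_left d (Real.pi / 2)]
        have h2 : (lam n).re = ‖lam n‖ * Real.cos (lam n).arg :=
          (Complex.norm_mul_cos_arg (lam n)).symm
        have h3 : ‖lam n‖ * Real.sin e ≤ -(lam n).re := by
          rw [h2]
          nlinarith
        have h4 : ‖lam n‖ / -(lam n).re ≤ (Real.sin e)⁻¹ := by
          rw [div_le_iff₀ hneg, inv_mul_eq_div, le_div_iff₀ hsin]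
          exact h3
        nlinarith [mul_nonneg hS0 hl, mul_nonneg ha'.le hl, mul_nonneg hs'.le hl]
      · have h4 : ‖lam n‖ / -(lam n).re ≤ a⁻¹ * ‖lam n‖ := by
          rw [div_le_iff₀ hneg, mul_assoc, inv_mul_eq_div, le_div_iff₀ ha]
          exact mul_le_mul_of_nonneg_left (by linarith) hl
        nlinarith [mul_nonneg hS0 hl, mul_nonneg ha'.le hl, mul_nonneg hs'.le hl]

theorem summable_norm_mul_of_sq {x y : ℕ → ℂ} (hx : Summable fun n => ‖x n‖ ^ 2)
    (hy : Summable fun n => ‖y n‖ ^ 2) : Summable fun n => ‖x n * y n‖ :=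
  Summable.of_nonneg_of_le (fun _ => norm_nonneg _) (fun n => by
    rw [norm_mul]
    nlinarith [sq_nonneg (‖x n‖ - ‖y n‖), sq_nonneg (‖x n‖), sq_nonneg (‖y n‖)]) (hx.add hy)

theorem summable_sq_of_le_off_finite {x y : ℕ → ℂ} {β : ℕ → ℝ} {K : ℝ}
    (hx : Summable fun n => ‖x n‖ ^ 2) (hy : Summable fun n => ‖y n‖ ^ 2) {N : Set ℕ}
    (hN : N.Finite) (hβ0 : ∀ n, 0 ≤ β n) (hβ : ∀ n ∉ N, β n ≤ K * (‖x n‖ + ‖y n‖)) :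
    Summable fun n => β n ^ 2 := by
  refine Summable.of_norm_bounded_eventually ((hx.add hy).mul_left (2 * K ^ 2)) ?_
  filter_upwards [hN.compl_mem_cofinite] with n hn
  rw [Real.norm_of_nonneg (by positivity)]
  refine (pow_le_pow_left₀ (hβ0 n) (hβ n hn) 2).trans ?_
  nlinarith [mul_nonneg (sq_nonneg K) (sq_nonneg (‖x n‖ - ‖y n‖))]

/-- Continuity of a Riesz basis expansion with dominated, continuous coefficients. -/
theorem IsRieszBasis.continuousOn_tsum {X : Type*} [NormedAddCommGroup X] [InnerProductSpace ℂ X]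
    [CompleteSpace X] {φ : ℕ → X} (hb : IsRieszBasis φ) {a : ℕ → ℂ → ℂ} {β : ℕ → ℝ} {s : Set ℂ}
    (hβ : Summable fun n => β n ^ 2) (ha : ∀ n, ContinuousOn (a n) s)
    (hab : ∀ n, ∀ w ∈ s, ‖a n w‖ ≤ β n) : ContinuousOn (fun w => ∑' n, a n w • φ n) s := by
  obtain ⟨Mb, hMb, hS⟩ := hb.exists_synthesis_bound
  have hsq : ∀ w ∈ s, Summable fun n => ‖a n w‖ ^ 2 := fun w hw =>
    hβ.of_nonneg_of_le (fun _ => by positivity) fun n =>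
      pow_le_pow_left₀ (norm_nonneg _) (hab n w hw) 2
  intro w₀ hw₀
  have hdiff : ∀ w ∈ s, ∀ n, ‖a n w - a n w₀‖ ^ 2 ≤ 4 * β n ^ 2 := fun w hw n => by
    have h1 : ‖a n w - a n w₀‖ ≤ 2 * β n :=
      (norm_sub_le _ _).trans (by linarith [hab n w hw, hab n w₀ hw₀])
    calc _ ≤ (2 * β n) ^ 2 := pow_le_pow_left₀ (norm_nonneg _) h1 2
      _ = _ := by ring
  have h1 : Tendsto (fun w => ∑' n, ‖a n w - a n w₀‖ ^ 2) (𝓝[s] w₀) (𝓝 (∑' _ : ℕ, (0 : ℝ))) := by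
    refine tendsto_tsum_of_dominated_convergence (hβ.mul_left 4) (fun n => ?_) ?_
    · have h2 : Tendsto (a n) (𝓝[s] w₀) (𝓝 (a n w₀)) := ha n w₀ hw₀
      simpa using ((h2.sub_const (a n w₀)).norm.pow 2)
    · filter_upwards [self_mem_nhdsWithin] with w hw n
      rw [Real.norm_of_nonneg (by positivity)]
      exact hdiff w hw n
  rw [tsum_zero] at h1
  refine tendsto_iff_norm_sub_tendsto_zero.2 ?_
  have h2 : Tendsto (fun w => Real.sqrt (Mb * ∑' n, ‖a n w - a n w₀‖ ^ 2)) (𝓝[s] w₀) (𝓝 0) := by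
    have := (Real.continuous_sqrt.tendsto _).comp (h1.const_mul Mb)
    simpa [Function.comp_def] using this
  refine squeeze_zero' (Eventually.of_forall fun _ => norm_nonneg _) ?_ h2
  filter_upwards [self_mem_nhdsWithin] with w hw
  have h3 := hS (fun n => a n w - a n w₀) ((hβ.mul_left 4).of_nonneg_of_le
    (fun _ => by positivity) (hdiff w hw))
  rw [← (hS _ (hsq w hw)).1.tsum_sub (hS _ (hsq w₀ hw₀)).1]
  simp only [sub_smul] at h3
  exact Real.le_sqrt_of_sq_le h3.2

/-- A collision needs τ(λ_n - λ_m) to be a nonzero multiple of 2πi, impossible for small τ on a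
finite set. It prevents two unstable modes from sharing a sampled eigenvalue. -/
theorem exists_injOn_exp_mul {lam : ℕ → ℂ} (hinj : Function.Injective lam) {N : Set ℕ}
    (hN : N.Finite) : ∃ τs : ℝ, 0 < τs ∧ ∀ τ : ℝ, 0 < τ → τ < τs →
      Set.InjOn (fun n => Complex.exp (τ * lam n)) N := by
  set R := ∑ n ∈ hN.toFinset, ‖lam n‖ with hR
  have hR0 : 0 ≤ R := Finset.sum_nonneg fun _ _ => norm_nonneg _
  have hle : ∀ n ∈ N, ‖lam n‖ ≤ R := fun n hn =>
    Finset.single_le_sum (f := fun n => ‖lam n‖) (fun _ _ => norm_nonneg _) (hN.mem_toFinset.2 hn)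
  refine ⟨1 / (R + 1), by positivity, fun τ hτ hτs n hn m hm hnm => ?_⟩
  obtain ⟨k, hk⟩ := Complex.exp_eq_exp_iff_exists_int.1 hnm
  have hτR : τ * (R + 1) < 1 := by rwa [lt_div_iff₀ (by positivity)] at hτs
  have h1 : ‖(k : ℂ) * (2 * Real.pi * Complex.I)‖ < 2 := by
    have : (k : ℂ) * (2 * Real.pi * Complex.I) = τ * (lam n - lam m) := by
      rw [mul_sub, hk]; ring
    rw [this, norm_mul, Complex.norm_real, Real.norm_of_nonneg hτ.le]
    calc τ * ‖lam n - lam m‖ ≤ τ * (R + R) := by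
          gcongr
          exact (norm_sub_le _ _).trans (add_le_add (hle n hn) (hle m hm))
      _ < 2 := by nlinarith
  have h2 : ‖(k : ℂ) * (2 * Real.pi * Complex.I)‖ = |(k : ℝ)| * (2 * Real.pi) := by
    rw [norm_mul, norm_mul, norm_mul, Complex.norm_I, Complex.norm_intCast, Complex.norm_real,
      Real.norm_of_nonneg Real.pi_pos.le]
    simp
  have hk0 : k = 0 := by
    by_contra hk0
    have h3 : (1 : ℝ) ≤ |(k : ℝ)| := by exact_mod_cast Int.one_le_abs hk0
    have := Real.pi_gt_three
    nlinarith
  rw [hk0, Int.cast_zero, zero_mul, add_zero] at hk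
  exact hinj (mul_left_cancel₀ (by exact_mod_cast hτ.ne') hk)

end Coefficients

/-! ### Consequences of closed-loop stability. -/

section SampledSystem

variable {X : Type*} [NormedAddCommGroup X] [InnerProductSpace ℂ X] [CompleteSpace X]
  {A : X →ₗ.[ℂ] X} {T : C0Semigroup X} {B : ℂ →L[ℂ] X} {F : X →L[ℂ] ℂ} {lam : ℕ → ℂ}
  {φ ψ : ℕ → X} {b f : X}

theorem SystemAssumption.re_ne_zero (h : SystemAssumption A B F lam φ ψ b f) (n : ℕ) :
    (lam n).re ≠ 0 := fun h0 => by
  have : lam n ∈ Set.range lam ∩ imagAxis := ⟨⟨n, rfl⟩, h0⟩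
  rw [h.no_imaginary] at this
  exact this

/-- The closed-loop operator has no eigenvalues in the closed right half-plane. -/
theorem SystemAssumption.not_isEigenpair (h : SystemAssumption A B F lam φ ψ b f) {s : ℂ}
    (hs : 0 ≤ s.re) (x : X) : ¬ IsEigenpair (addBounded A (B.comp F)) s x := by
  intro hx
  rcases hs.eq_or_lt with h0 | h0
  · have : s ∈ pointSpectrum (addBounded A (B.comp F)) ∩ imagAxis := ⟨⟨x, hx⟩, h0.symm⟩
    rw [h.closedLoop_pointSpectrum] at this
    exact this
  · obtain ⟨S, hS, hSb⟩ := h.closedLoop_bounded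
    exact not_isEigenpair_of_uniformlyBounded hS hSb h0 x hx

/-- Otherwise ψ_n stays an unstable left eigenvector of A + BF; boundedness would make it orthogonal
to the domain, against ⟨φ_n, ψ_n⟩ = 1. -/
theorem SystemAssumption.control_ne_zero (h : SystemAssumption A B F lam φ ψ b f)
    (hT : IsGenerator A T) {n : ℕ} (hn : 0 < (lam n).re) : (inner ℂ (ψ n) b : ℂ) ≠ 0 := by
  intro hb
  obtain ⟨S, hS, hSb⟩ := h.closedLoop_bounded
  obtain ⟨-, hd, -⟩ := h.rieszSpectral.eigenvector n
  have h1 := inner_eq_zero_of_uniformlyBounded hS hSb hn (y := ψ n) (fun x => by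
    have e : (addBounded A (B.comp F)) x = B (F (x : X)) + A ⟨x, x.2⟩ := rfl
    rw [e, inner_add_right, h.control_eq, inner_smul_right, hb, mul_zero, zero_add]
    exact inner_generator_apply hT h.rieszSpectral h.biorthogonal n ⟨x, x.2⟩) ⟨φ n, hd⟩
  have h2 := h.biorthogonal n n
  simp only [if_true] at h2
  exact one_ne_zero (h2.symm.trans h1)

/-- Otherwise Fφ_n = 0 and φ_n is an unstable closed-loop eigenvector. -/
theorem SystemAssumption.feedback_ne_zero (h : SystemAssumption A B F lam φ ψ b f) {n : ℕ}
    (hn : 0 < (lam n).re) : (inner ℂ f (φ n) : ℂ) ≠ 0 := by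
  intro hf
  obtain ⟨h0, hd, he⟩ := h.rieszSpectral.eigenvector n
  refine h.not_isEigenpair hn.le (φ n) ⟨h0, hd, ?_⟩
  have e : (addBounded A (B.comp F)) ⟨φ n, hd⟩ = B (F (φ n)) + A ⟨φ n, hd⟩ := rfl
  rw [e, h.feedback_eq, hf, map_zero, zero_add, he]

/-- If the sum were 1, the solution x of (s - A)x = b would satisfy Fx = 1, hence (A + BF)x = sx.
The expansion of x converges even at s = 0 because |s - λ_n| ≥ -Re λ_n on stable modes. -/
theorem SystemAssumption.tsum_transfer_ne_one (h : SystemAssumption A B F lam φ ψ b f) {K : ℝ}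
    (hfin : {n | 0 < (lam n).re}.Finite)
    (hK : ∀ n, (lam n).re < 0 → ‖lam n‖ / -(lam n).re ≤ K * (1 + ‖lam n‖))
    {s : ℂ} (hs : 0 ≤ s.re) (hsl : ∀ n, s ≠ lam n) :
    ∑' n, inner ℂ (ψ n) b / (s - lam n) * inner ℂ f (φ n) ≠ (1 : ℂ) := by
  intro hsum
  obtain ⟨Ma, hMa, hAn⟩ := exists_analysis_bound h.rieszSpectral.basis h.biorthogonal
  obtain ⟨Mb, hMb, hS⟩ := h.rieszSpectral.basis.exists_synthesis_bound
  have hsq : Summable fun n => ‖(inner ℂ (ψ n) b : ℂ) / (s - lam n)‖ ^ 2 := by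
    refine summable_sq_of_le_off_finite (K := K) h.control_summable (hAn b).1 hfin
      (fun _ => norm_nonneg _) fun n hn => ?_
    have hneg : (lam n).re < 0 := lt_of_le_of_ne (not_lt.1 hn) (h.re_ne_zero n)
    have hl : 0 < ‖lam n‖ := norm_pos_iff.2 fun h0 => h.re_ne_zero n (by rw [h0]; rfl)
    have h1 : -(lam n).re ≤ ‖s - lam n‖ := by
      have := (le_abs_self _).trans (Complex.abs_re_le_norm (s - lam n))
      rw [Complex.sub_re] at this
      linarith
    have h2 := hK n hneg
    rw [div_le_iff₀ (by linarith)] at h2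
    have hK0 : 0 ≤ K * (1 + ‖lam n‖) := by
      by_contra! hlt
      have := mul_neg_of_neg_of_pos hlt (neg_pos.2 hneg)
      linarith
    have h3 : ‖lam n‖ ≤ K * (1 + ‖lam n‖) * ‖s - lam n‖ :=
      h2.trans (mul_le_mul_of_nonneg_left h1 hK0)
    rw [norm_div, norm_div, div_le_iff₀ (by linarith)]
    calc ‖(inner ℂ (ψ n) b : ℂ)‖ = ‖(inner ℂ (ψ n) b : ℂ)‖ / ‖lam n‖ * ‖lam n‖ := by field_simp
      _ ≤ ‖(inner ℂ (ψ n) b : ℂ)‖ / ‖lam n‖ * (K * (1 + ‖lam n‖) * ‖s - lam n‖) := by gcongr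
      _ = _ := by field_simp
  obtain ⟨hx, hAx⟩ := exists_resolvent_expansion h.rieszSpectral h.biorthogonal b hsl hsq
  set x := ∑' n, ((inner ℂ (ψ n) b : ℂ) / (s - lam n)) • φ n with hxdef
  have hFx : F x = 1 := by
    have h1 := (F.hasSum (hS _ hsq).1.hasSum).tsum_eq
    rw [← hsum, ← h1]
    refine tsum_congr fun n => ?_
    rw [map_smul, h.feedback_eq, smul_eq_mul]
  refine h.not_isEigenpair hs x ⟨fun h0 => ?_, hx, ?_⟩
  · rw [h0, map_zero] at hFx
    exact zero_ne_one hFx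
  · have e : (addBounded A (B.comp F)) ⟨x, hx⟩ = B (F x) + A ⟨x, hx⟩ := rfl
    rw [e, hAx, hFx, h.control_eq, one_smul]
    abel

/-- Powers do not increase any coordinate; comparing norm and coefficients costs only the Riesz
constants. -/
theorem exists_pow_bound_of_inner_eq (hb : IsRieszBasis φ)
    (hbi : ∀ n m, inner ℂ (ψ m) (φ n) = if n = m then (1 : ℂ) else 0) {D : X →L[ℂ] X} {μ : ℕ → ℂ}
    (hμ : ∀ n, ‖μ n‖ ≤ 1) (hD : ∀ n x, (inner ℂ (ψ n) (D x) : ℂ) = μ n * inner ℂ (ψ n) x) :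
    ∃ M : ℝ, ∀ k : ℕ, ‖D ^ k‖ ≤ M := by
  obtain ⟨Ma, hMa, hAn⟩ := exists_analysis_bound hb hbi
  obtain ⟨Mb, hMb, hN⟩ := exists_norm_sq_le_tsum hb hbi
  refine ⟨Real.sqrt (Mb / Ma), fun k => ContinuousLinearMap.opNorm_le_bound _ (by positivity)
    fun x => ?_⟩
  have hle : ∀ n, ‖(inner ℂ (ψ n) ((D ^ k) x) : ℂ)‖ ≤ ‖(inner ℂ (ψ n) x : ℂ)‖ := by
    intro n
    induction k with
    | zero => simp
    | succ k ih =>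
      rw [pow_succ', mul_apply_eq_comp, hD, norm_mul]
      exact (mul_le_of_le_one_left (norm_nonneg _) (hμ n)).trans ih
  refine le_of_sq_le_sq ?_ (by positivity)
  rw [mul_pow, Real.sq_sqrt (by positivity)]
  calc ‖(D ^ k) x‖ ^ 2 ≤ Mb * ∑' n, ‖(inner ℂ (ψ n) ((D ^ k) x) : ℂ)‖ ^ 2 := hN _
    _ ≤ Mb * ∑' n, ‖(inner ℂ (ψ n) x : ℂ)‖ ^ 2 := by
      refine mul_le_mul_of_nonneg_left ?_ hMb.le
      exact (hAn _).1.tsum_le_tsum (fun n => pow_le_pow_left₀ (norm_nonneg _) (hle n) 2) (hAn x).1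
    _ ≤ Mb * (‖x‖ ^ 2 / Ma) := by
      gcongr
      rw [le_div_iff₀' hMa]
      exact (hAn x).2
    _ = _ := by ring

end SampledSystem

/-! ### Unique solvability and power boundedness of the sampled system. -/

section Main

variable {X : Type*} [NormedAddCommGroup X] [InnerProductSpace ℂ X] [CompleteSpace X]
  {A : X →ₗ.[ℂ] X} {T : C0Semigroup X} {B : ℂ →L[ℂ] X} {F : X →L[ℂ] ℂ} {lam : ℕ → ℂ}
  {φ ψ : ℕ → X} {b f : X}

/-- The sampled system has no nontrivial solutions of the eigenvalue equation on or outside the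
unit circle, for small sampling periods. The parameter `w` is the inverse of the eigenvalue. -/
theorem SystemAssumption.exists_unique_solvability (h : SystemAssumption A B F lam φ ψ b f)
    (hT : IsGenerator A T) {K : ℝ} (hfin : {n | 0 < (lam n).re}.Finite)
    (hK : ∀ n, (lam n).re < 0 → ‖lam n‖ / -(lam n).re ≤ K * (1 + ‖lam n‖)) :
    ∃ τs : ℝ, 0 < τs ∧ ∀ τ : ℝ, 0 < τ → τ < τs → ∀ w : ℂ, ‖w‖ ≤ 1 → ∀ x : X,
      (∀ n, (1 - w * Complex.exp (τ * lam n)) * inner ℂ (ψ n) x =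
        F x * (w * (Complex.exp (τ * lam n) - 1) * (inner ℂ (ψ n) b / lam n))) → x = 0 := by
  have hA := h.rieszSpectral
  have hbi := h.biorthogonal
  have hl0 : ∀ n, lam n ≠ 0 := fun n h0 => h.re_ne_zero n (by rw [h0]; rfl)
  obtain ⟨Ma, hMa, hAn⟩ := exists_analysis_bound hA.basis hbi
  set c : ℕ → ℂ := fun n => inner ℂ (ψ n) b / lam n * inner ℂ f (φ n) with hc
  have hcl : ∀ n, c n * lam n = inner ℂ (ψ n) b * inner ℂ f (φ n) := fun n => by
    rw [hc]
    field_simp [hl0 n]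
  obtain ⟨τ₁, hτ₁, H₁⟩ := exists_forall_tsum_sampled_mode_ne_one (c := c) hA.distinct h.re_ne_zero
    hfin hK (summable_norm_mul_of_sq h.control_summable (hA.basis.summable_sq_inner f))
    (by
      simp only [hcl]
      exact summable_norm_mul_of_sq (hAn b).1 (hA.basis.summable_sq_inner f))
    (by
      have := h.control_feedback
      simpa only [mul_div_right_comm] using this)
    (fun s hs _ hsl => by
      have := h.tsum_transfer_ne_one hfin hK hs hsl
      refine fun h1 => this (h1.symm.trans (tsum_congr fun n => ?_)).symm
      rw [← mul_div_assoc, hcl, mul_div_right_comm])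
    (fun n hn => mul_ne_zero (div_ne_zero (h.control_ne_zero hT hn) (hl0 n))
      (h.feedback_ne_zero hn))
  obtain ⟨τ₂, hτ₂, H₂⟩ := exists_injOn_exp_mul hA.distinct hfin
  refine ⟨min τ₁ τ₂, lt_min hτ₁ hτ₂, fun τ hτ hτs w hw x hx => ?_⟩
  have hF : HasSum (fun n => (inner ℂ (ψ n) x : ℂ) * inner ℂ f (φ n)) (F x) := by
    have := F.hasSum (hasSum_inner_smul hA.basis hbi x)
    simpa only [map_smul, smul_eq_mul, ← h.feedback_eq] using this
  have hzero : (∀ n, (inner ℂ (ψ n) x : ℂ) = 0) → x = 0 := fun h0 =>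
    ext_inner_of_rieszBasis hA.basis hbi fun n => by rw [h0, inner_zero_right]
  by_cases hw0 : w = 0
  · refine hzero fun n => ?_
    simpa [hw0] using hx n
  by_cases hall : ∀ n, 1 - w * Complex.exp (τ * lam n) ≠ 0
  · have hG := H₁ τ hτ (hτs.trans_le (min_le_left _ _)) w hw hw0 hall
    have hxn : ∀ n, (inner ℂ (ψ n) x : ℂ) = F x * (w * (Complex.exp (τ * lam n) - 1) *
        (inner ℂ (ψ n) b / lam n) / (1 - w * Complex.exp (τ * lam n))) := fun n => by
      rw [← mul_div_assoc, eq_div_iff (hall n), ← hx n, mul_comm]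
    have hF2 : F x = F x * ∑' n, c n * (w * (Complex.exp (τ * lam n) - 1) /
        (1 - w * Complex.exp (τ * lam n))) := by
      rw [← tsum_mul_left]
      nth_rewrite 1 [← hF.tsum_eq]
      refine tsum_congr fun n => ?_
      rw [hxn n, hc]
      ring
    have hFx : F x = 0 := by
      by_contra hne
      exact hG (mul_left_cancel₀ hne (by rw [← hF2, mul_one]))
    exact hzero fun n => by rw [hxn, hFx, zero_mul]
  · push Not at hall
    obtain ⟨m, hm⟩ := hall
    have hpos : ∀ n, 1 - w * Complex.exp (τ * lam n) = 0 → 0 < (lam n).re := fun n hn => by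
      by_contra hneg
      exact one_sub_mul_exp_ne_zero (lt_of_le_of_ne (not_lt.1 hneg) (h.re_ne_zero n)) hτ hw hn
    have hmpos := hpos m hm
    have hexp : Complex.exp (τ * lam m) - 1 ≠ 0 := by
      intro h1
      have h2 := congrArg norm (sub_eq_zero.1 h1)
      rw [norm_one, Complex.norm_exp, Real.exp_eq_one_iff] at h2
      rw [Complex.re_ofReal_mul] at h2
      exact (mul_pos hτ hmpos).ne' h2
    have hFx : F x = 0 := by
      have := hx m
      rw [hm, zero_mul, eq_comm, mul_eq_zero] at this
      exact this.resolve_right (mul_ne_zero (mul_ne_zero hw0 hexp)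
        (div_ne_zero (h.control_ne_zero hT hmpos) (hl0 m)))
    have hxn : ∀ n, n ≠ m → (inner ℂ (ψ n) x : ℂ) = 0 := fun n hn => by
      have h1 := hx n
      rw [hFx, zero_mul, mul_eq_zero] at h1
      refine h1.resolve_left fun h2 => hn ?_
      refine H₂ τ hτ (hτs.trans_le (min_le_right _ _)) (hpos n h2) hmpos ?_
      exact mul_left_cancel₀ hw0 ((sub_eq_zero.1 h2).symm.trans (sub_eq_zero.1 hm))
    have hFm := hF.unique (hasSum_single m fun n hn => by rw [hxn n hn, zero_mul])
    rw [hFx, eq_comm, mul_eq_zero] at hFm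
    have hxm := hFm.resolve_right (h.feedback_ne_zero hmpos)
    exact hzero fun n => by
      by_cases hn : n = m
      · rw [hn, hxm]
      · exact hxn n hn

/-- The hypothesis `hinj` is x = wΔ(τ)x in coordinates. The unstable modes join S(τ)F in a
finite-rank perturbation, indexed by `Option N`: `none` for the feedback, `some m` for mode m. -/
theorem SystemAssumption.powerBounded_of_solvability (h : SystemAssumption A B F lam φ ψ b f)
    (hT : IsGenerator A T) {K : ℝ} (hfin : {n | 0 < (lam n).re}.Finite)
    (hK : ∀ n, (lam n).re < 0 → ‖lam n‖ / -(lam n).re ≤ K * (1 + ‖lam n‖)) {τ : ℝ} (hτ : 0 < τ)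
    (hinj : ∀ w : ℂ, ‖w‖ ≤ 1 → ∀ x : X,
      (∀ n, (1 - w * Complex.exp (τ * lam n)) * inner ℂ (ψ n) x =
        F x * (w * (Complex.exp (τ * lam n) - 1) * (inner ℂ (ψ n) b / lam n))) → x = 0) :
    PowerBounded (sampledOperator T B F τ) := by
  classical
  have hA := h.rieszSpectral
  have hbi := h.biorthogonal
  have hl0 : ∀ n, lam n ≠ 0 := fun n h0 => h.re_ne_zero n (by rw [h0]; rfl)
  obtain ⟨Ma, hMa, hAn⟩ := exists_analysis_bound hA.basis hbi
  set N : Finset ℕ := hfin.toFinset with hN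
  have hNpos : ∀ n, n ∈ N ↔ 0 < (lam n).re := fun n => by simp [hN]
  have hneg : ∀ n, n ∉ N → (lam n).re < 0 := fun n hn =>
    lt_of_le_of_ne (not_lt.1 fun h0 => hn ((hNpos n).2 h0)) (h.re_ne_zero n)
  set μ : ℕ → ℂ := fun n => Complex.exp (τ * lam n) with hμ
  set μs : ℕ → ℂ := fun n => if n ∈ N then 0 else μ n with hμs
  have hμs1 : ∀ n, ‖μs n‖ ≤ 1 := fun n => by
    rw [hμs]
    simp only
    split_ifs with hn
    · simp
    · rw [hμ, Complex.norm_exp, Complex.re_ofReal_mul, Real.exp_le_one_iff]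
      exact (mul_neg_of_pos_of_neg hτ (hneg n hn)).le
  have hden : ∀ n (w : ℂ), ‖w‖ ≤ 1 → 1 - w * μs n ≠ 0 := fun n w hw => by
    rw [hμs]
    simp only
    split_ifs with hn
    · simp
    · exact one_sub_mul_exp_ne_zero (hneg n hn) hτ hw
  set σ : X := inputMap T B τ 1 with hσ
  have hσn : ∀ n, (inner ℂ (ψ n) σ : ℂ) = (μ n - 1) * (inner ℂ (ψ n) b / lam n) := fun n =>
    inner_inputMap hT hA hbi h.control_eq n (hl0 n) hτ.le
  set P : X →L[ℂ] X := finiteRank (fun m : N => ψ m) (fun m : N => μ m • φ m) with hP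
  have hPn : ∀ n x, (inner ℂ (ψ n) (P x) : ℂ) =
      if n ∈ N then μ n * inner ℂ (ψ n) x else 0 := fun n x => by
    rw [hP, finiteRank_apply, Finset.sum_coe_sort N fun m => (inner ℂ (ψ m) x : ℂ) • μ m • φ m]
    simp only [smul_smul]
    rw [inner_sum_of_biorthogonal hbi]
    simp only [mul_comm]
  set T' : X →L[ℂ] X := T.T τ - P with hT'
  have hT'n : ∀ n x, (inner ℂ (ψ n) (T' x) : ℂ) = μs n * inner ℂ (ψ n) x := fun n x => by
    rw [hT', sub_apply, inner_sub_right, inner_semigroup_apply hT hA hbi n hτ.le, hPn, hμs]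
    simp only
    split_ifs
    · ring
    · ring
  obtain ⟨M, hM⟩ := exists_pow_bound_of_inner_eq hA.basis hbi hμs1 hT'n
  set v : Option N → X := fun i => i.elim f fun m => ψ m with hv
  set u : Option N → X := fun i => i.elim σ fun m => μ m • φ m with hu
  have hD : sampledOperator T B F τ = T' + finiteRank v u := by
    ext x
    rw [add_apply, finiteRank_apply, Fintype.sum_option, sampledOperator, add_apply, hT', sub_apply,
      hP, finiteRank_apply]
    have : ((inputMap T B τ).comp F) x = (inner ℂ f x : ℂ) • σ := by
      rw [ContinuousLinearMap.comp_apply, h.feedback_eq, hσ, ← map_smul, smul_eq_mul, mul_one]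
    rw [this]
    simp only [hv, hu, Option.elim]
    abel
  -- Coefficients of (1 - wT')⁻¹ wσ, with a square-summable bound `β` valid on the whole closed
  -- disc.
  set a : ℕ → ℂ → ℂ := fun n w =>
    w * (μ n - 1) / (1 - w * μs n) * (inner ℂ (ψ n) b / lam n) with ha
  set β : ℕ → ℝ := fun n => (if n ∈ N then ‖μ n - 1‖ else K * (1 + ‖lam n‖)) *
    ‖(inner ℂ (ψ n) b : ℂ) / lam n‖ with hβ
  have hab : ∀ n, ∀ w ∈ Metric.closedBall (0 : ℂ) 1, ‖a n w‖ ≤ β n := fun n w hw => by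
    have hw1 : ‖w‖ ≤ 1 := by simpa using hw
    rw [ha, hβ]
    simp only
    rw [norm_mul]
    refine mul_le_mul_of_nonneg_right ?_ (norm_nonneg _)
    rw [hμs]
    simp only
    split_ifs with hn
    · rw [mul_zero, sub_zero, div_one, norm_mul]
      exact mul_le_of_le_one_left (norm_nonneg _) hw1
    · exact (norm_sampled_mode_le (hneg n hn) hτ hw1).trans (hK n (hneg n hn))
  have hβ0 : ∀ n, 0 ≤ β n := fun n => (norm_nonneg _).trans (hab n 0 (by simp))
  have hβs : Summable fun n => β n ^ 2 := by
    refine summable_sq_of_le_off_finite (K := K) h.control_summable (hAn b).1 N.finite_toSet hβ0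
      fun n hn => ?_
    rw [hβ]
    simp only
    rw [if_neg (by simpa using hn), norm_div]
    have : ‖lam n‖ ≠ 0 := norm_ne_zero_iff.2 (hl0 n)
    refine le_of_eq ?_
    field_simp
  have hac : ∀ n, ContinuousOn (a n) (Metric.closedBall 0 1) := fun n => by
    refine ContinuousOn.mul (ContinuousOn.div (by fun_prop) (by fun_prop) fun w hw => ?_)
      continuousOn_const
    exact hden n w (by simpa using hw)
  -- T' annihilates φ_m for m in `N`, so (1 - wT')⁻¹ fixes w μ_m φ_m.
  set k : Option N → ℂ → X := fun i =>
    i.elim (fun w => ∑' n, a n w • φ n) fun m w => (w * μ m) • φ m with hk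
  obtain ⟨Mb, hMb, hS⟩ := hA.basis.exists_synthesis_bound
  have hkn : ∀ w : ℂ, ‖w‖ ≤ 1 → ∀ n, (inner ℂ (ψ n) (k none w) : ℂ) = a n w := fun w hw n =>
    inner_tsum_of_biorthogonal hbi (hS _ (hβs.of_nonneg_of_le (fun _ => by positivity) fun n =>
      pow_le_pow_left₀ (norm_nonneg _) (hab n w (by simpa using hw)) 2)).1 n
  have hkm : ∀ (m : N) (w : ℂ) n, (inner ℂ (ψ n) (k (some m) w) : ℂ) =
      if n = m then w * μ n else 0 := fun m w n => by
    simp only [hk, Option.elim, inner_smul_right, hbi]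
    by_cases hnm : n = m
    · simp [hnm]
    · simp [hnm, Ne.symm hnm]
  rw [hD]
  refine powerBounded_add_finiteRank hM v u k ?_ ?_ ?_
  · rintro (_ | m)
    · exact hA.basis.continuousOn_tsum hβs hac hab
    · simp only [hk, Option.elim]
      fun_prop
  · rintro (_ | m) w hw
    · refine ext_inner_of_rieszBasis hA.basis hbi fun n => ?_
      rw [sub_apply, one_apply_eq_self, smul_apply, inner_sub_right, inner_smul_right, hT'n,
        hkn w hw, inner_smul_right]
      simp only [hu, Option.elim]
      rw [hσn, ha]
      have := hden n w hw
      field_simp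
    · refine ext_inner_of_rieszBasis hA.basis hbi fun n => ?_
      rw [sub_apply, one_apply_eq_self, smul_apply, inner_sub_right, inner_smul_right, hT'n,
        hkm, inner_smul_right]
      simp only [hu, Option.elim, inner_smul_right, hbi]
      by_cases hnm : n = m
      · have : μs n = 0 := by simp [hμs, hnm]
        simp [hnm]
        simp [← hnm, this]
      · simp [hnm, Ne.symm hnm]
  · intro w hw x hx
    refine hinj w hw x fun n => ?_
    -- In coordinates the fixed-point equation is (1 - w e^{τλ_n})x_n = Fx · (...) after clearing
    -- the denominator on stable modes, or moving the removed term back on unstable ones.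
    have h1 : (inner ℂ (ψ n) x : ℂ) = F x * a n w +
        if n ∈ N then w * μ n * inner ℂ (ψ n) x else 0 := by
      conv_lhs => rw [hx]
      rw [Fintype.sum_option, inner_add_right, inner_smul_right, hkn w hw, inner_sum]
      simp only [inner_smul_right, hkm]
      have e1 : (inner ℂ (v none) x : ℂ) = F x := (h.feedback_eq x).symm
      rw [e1]
      congr 1
      have e2 : ∀ m : N, (inner ℂ (v (some m)) x : ℂ) * (if n = m then w * μ n else 0) =
          if n = m then w * μ n * inner ℂ (ψ n) x else 0 := fun m => by
        by_cases hnm : n = m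
        · simp only [hv, Option.elim, hnm, if_true]
          ring
        · simp [hnm]
      simp only [e2]
      rw [Finset.sum_coe_sort N fun m => if n = m then w * μ n * inner ℂ (ψ n) x else 0]
      simp
    have hd := hden n w hw
    rw [ha] at h1
    simp only [hμs] at h1 hd
    by_cases hn : n ∈ N
    · simp only [hn, if_true, mul_zero, sub_zero, div_one] at h1
      linear_combination h1
    · simp only [hn, if_false, add_zero] at h1 hd
      rw [h1, show Complex.exp (τ * lam n) = μ n from rfl]
      field_simp

end Main

end SampledData
theorem theorem4p1 {X : Type*} [NormedAddCommGroup X] [InnerProductSpace ℂ X] [CompleteSpace X]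
    (A : X →ₗ.[ℂ] X) (T : SampledData.C0Semigroup X) (hT : SampledData.IsGenerator A T)
    (B : ℂ →L[ℂ] X) (F : X →L[ℂ] ℂ) (lam : ℕ → ℂ) (φ ψ : ℕ → X) (b f : X)
    (h : SampledData.SystemAssumption A B F lam φ ψ b f) :
    ∃ τs : ℝ, 0 < τs ∧ ∀ τ : ℝ, 0 < τ → τ < τs →
      SampledData.PowerBounded (SampledData.sampledOperator T B F τ) := by
  obtain ⟨a, d, ha, hd, hfin⟩ := h.finite_unstable
  obtain ⟨hN, K, -, hK⟩ :=
    SampledData.exists_inclination_bound h.rieszSpectral.distinct ha hd hfin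
  obtain ⟨τs, hτs, H⟩ := h.exists_unique_solvability hT hN hK
  exact ⟨τs, hτs, fun τ h0 h1 => h.powerBounded_of_solvability hT hN hK h0 (H τ h0 h1)⟩
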